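/- Let $n\ge 1$ and $M\ge 2$ be integers. Let $H=\bigcup_{m=2}^M H_m$ be a random hypergraph on $[n]=\{1,\dots,n\}$, where each $H_m=([n],E_m)$ is an inhomogeneous $m$-uniform Erdős–Rényi hypergraph: all potential hyperedges $e\subset[n]$ with $|e|=m$, $2\le m\le M$, appear independently of each other (for the same $m$ and for different $m$), and $e$ with $|e|=m$ belongs to $E_m$ with probability $d_e/\binom{n}{m-1}$, where the numbers $d_e\ge 0$ are such that these are probabilities. Put $d_m=\max_{|e|=m}d_e$ (with $d_m=0$ if $m>n$) and $d=\sum_{m=2}^M(m-1)d_m$. Let $A$ be the $n\times n$ adjacency matrix of $H$: $A_{ii}=0$, and for $i\neq j$, $A_{ij}=\sum_{m=2}^M|\{e\in E_m:\{i,j\}\subset e\}|$. Suppose that $d\ge c\log n$ for some constant $c>0$. Then for every $K>0$, with $$C=512\,M(M-1)(K+6)\left[2+\frac{(M-1)(1+K)}{c}\right],$$ we have $$\mathbb P\left(\|A-\mathbb E A\|\le C\sqrt d\right)\ \ge\ 1-2n^{-K}-2e^{-n},$$ where $\|\cdot\|$ is the spectral norm. -/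

import Mathlib

open MeasureTheory ProbabilityTheory

noncomputable section

/-- An `m`-uniform hypergraph on the vertex set `[n]`: every hyperedge consists of exactly `m`
distinct vertices. -/
structure UniformHypergraph (n m : ℕ) extends Hypergraph (Fin n) where
  vertexSet_eq : vertexSet = Set.univ
  card_eq : ∀ e : Finset (Fin n), (e : Set (Fin n)) ∈ edgeSet → e.card = m

/-- The hyperedges, as finite sets of vertices. -/
def UniformHypergraph.edges {n m : ℕ} (H : UniformHypergraph n m) : Set (Finset (Fin n)) :=
  {e | (e : Set (Fin n)) ∈ H.edgeSet}

/-- The entry at `e = {i₁, …, iₘ}` of the (symmetric) adjacency tensor of a uniform hypergraph: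
it is `1` if `e` is a hyperedge and `0` otherwise. -/
def UniformHypergraph.tensor {n m : ℕ} (H : UniformHypergraph n m) (e : Finset (Fin n)) : ℝ :=
  H.edges.indicator (fun _ => (1 : ℝ)) e

/-- The adjacency matrix of the non-uniform hypergraph `⋃_{m=2}^M H m`: the diagonal is zero, and
the `(i, j)` entry with `i ≠ j` counts the hyperedges that contain both `i` and `j`. -/
def adjacencyMatrix {n : ℕ} (M : ℕ) (H : (m : ℕ) → UniformHypergraph n m) :
    Matrix (Fin n) (Fin n) ℝ :=
  Matrix.of fun i j =>
    if i = j then 0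
    else ∑ m ∈ Finset.Icc 2 M,
      ∑ e ∈ (Finset.powersetCard m Finset.univ).filter (fun e => {i, j} ⊆ e), (H m).tensor e

/-- `H = ⋃_{m=2}^M H m` is a random hypergraph on `[n]` in which each `H m` is an inhomogeneous
Erdős–Rényi hypergraph of order `m` with probability tensor `d e / C(n, m - 1)`: all the potential
hyperedges, of all orders `2 ≤ m ≤ M`, appear independently of each other, and `e` with `|e| = m`
appears with probability `d e / C(n, m - 1)`. -/
structure IsInhomogeneousErdosRenyi {Ω : Type*} [MeasurableSpace Ω] (P : Measure Ω) {n : ℕ}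
    (M : ℕ) (H : (m : ℕ) → Ω → UniformHypergraph n m) (d : Finset (Fin n) → ℝ) : Prop where
  measurableSet_edge : ∀ m ∈ Finset.Icc 2 M, ∀ e : Finset (Fin n), e.card = m →
    MeasurableSet {ω | e ∈ (H m ω).edges}
  prob_edge : ∀ m ∈ Finset.Icc 2 M, ∀ e : Finset (Fin n), e.card = m →
    P.real {ω | e ∈ (H m ω).edges} = d e / (n.choose (m - 1) : ℝ)
  indep_edges : iIndepSet
    (fun e : {e : Finset (Fin n) // e.card ∈ Finset.Icc 2 M} =>
      {ω | e.1 ∈ (H e.1.card ω).edges}) P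

/-- `d_m`, the maximum of `d e` over the `m`-element sets `e` of vertices (it is `0` if there are
no such sets, that is, if `m > n`). -/
def maxDensity {n : ℕ} (d : Finset (Fin n) → ℝ) (m : ℕ) : ℝ :=
  ⨆ e : {e : Finset (Fin n) // e.card = m}, d e.1

/-- `d = ∑_{m=2}^M (m - 1) d_m`. -/
def totalDensity {n : ℕ} (M : ℕ) (d : Finset (Fin n) → ℝ) : ℝ :=
  ∑ m ∈ Finset.Icc 2 M, ((m : ℝ) - 1) * maxDensity d m

/-- The entrywise expectation of a random matrix. -/
def expectedMatrix {Ω : Type*} [MeasurableSpace Ω] (P : Measure Ω) {n : ℕ}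
    (A : Ω → Matrix (Fin n) (Fin n) ℝ) : Matrix (Fin n) (Fin n) ℝ :=
  Matrix.of fun i j => ∫ ω, A ω i j ∂P

/-- The spectral norm: the operator norm of the matrix on Euclidean space. -/
def matrixSpectralNorm {n : ℕ} (A : Matrix (Fin n) (Fin n) ℝ) : ℝ :=
  ‖Matrix.toEuclideanCLM (n := Fin n) (𝕜 := ℝ) A‖

end

/-! ### Exponential tail bounds for sums of independent indicators -/

section Tails

variable {Ω ι : Type*} [MeasurableSpace Ω] {P : Measure Ω} [IsProbabilityMeasure P] [Fintype ι]
  {s : ι → Set Ω}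

/-! The argument is that of Kahn and Szemerédi. Write `r = √d` and `w = M(M - 1)`. As `A - 𝔼A` is
symmetric, a quarter-net of the unit ball reduces its norm, up to a factor 2, to the quadratic forms
`∑ x_i x_j (A - 𝔼A)_ij` at no more than `9 ^ n` fixed vectors `x`. The entries of `A` are dependent,
but every pairing `∑ φ_ij A_ij` is, by double counting (`sum_mul_edgeMatrix`), a linear combination
of independent hyperedge indicators. Its coefficients are at most `w max |φ|` in absolute value, and
means and variances are controlled by `𝔼A_ij ≤ d / n` (`edgeMatrix_prob_le`).

A pair `(i, j)` is heavy if the dyadic roundings of `√n |x_i|` and `√n |x_j|` have product at least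
`r`. On light pairs `|x_i x_j| ≤ 4r / n`, so a Bernstein bound at height `16wr` beats the size of
the net (`prob_light_le`).

Heavy pairs have coefficients too large for that bound. Their `𝔼A` part is at most `r`
deterministically. Their `A` part is bounded for all `x` at once, given two properties of `A`: row
sums are `O(d)`, and for any vertex sets `I`, `J` the edge count is either at most `e²` times
`d|I||J| / n` or is controlled by the entropy of the larger set. Both properties follow from
Chernoff and union bounds (`prob_degree_gt_le`, `prob_exists_isDiscrepant_le`); in the first, `d ≥ c
log n` pays for the union over vertices. Given them, `heavy_dyadic_sum_le` bounds each pair of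
dyadic scales by quantities whose sums over scales are geometric and total `O(r)`, with no
logarithmic loss. The failure probabilities are `n^{-K}`, `n^{-K}` and `2e^{-n}`. -/

lemma integrable_exp_mul_indicator {t : Set Ω} (ht : MeasurableSet t) (c : ℝ) :
    Integrable (fun ω => Real.exp (c * t.indicator (1 : Ω → ℝ) ω)) P := by
  have h : (fun ω => Real.exp (c * t.indicator (1 : Ω → ℝ) ω)) =
      fun ω => t.indicator (fun _ => Real.exp c - 1) ω + 1 := by
    ext ω; by_cases hω : ω ∈ t <;> simp [hω]
  rw [h]
  exact ((integrable_const _).indicator ht).add (integrable_const _)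

lemma integral_exp_mul_indicator {t : Set Ω} (ht : MeasurableSet t) (c : ℝ) :
    ∫ ω, Real.exp (c * t.indicator (1 : Ω → ℝ) ω) ∂P = 1 + P.real t * (Real.exp c - 1) := by
  have h : (fun ω => Real.exp (c * t.indicator (1 : Ω → ℝ) ω)) =
      fun ω => t.indicator (fun _ => Real.exp c - 1) ω + 1 := by
    ext ω; by_cases hω : ω ∈ t <;> simp [hω]
  rw [h, integral_add ((integrable_const _).indicator ht) (integrable_const _),
    integral_indicator_const _ ht]
  simp [add_comm]

/-- Exponential Markov inequality for a linear combination of independent indicators. -/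
lemma prob_le_sum_indicator (hs : ∀ i, MeasurableSet (s i)) (hi : iIndepSet s P)
    (c : ι → ℝ) (τ : ℝ) :
    P.real {ω | τ ≤ ∑ i, c i * (s i).indicator (1 : Ω → ℝ) ω} ≤
      Real.exp (-τ + ∑ i, P.real (s i) * (Real.exp (c i) - 1)) := by
  have hX : iIndepFun (fun i ω => c i * (s i).indicator (1 : Ω → ℝ) ω) P :=
    (hi.iIndepFun_indicator (β := ℝ)).comp (fun i x => c i * x)
      (fun i => measurable_const.mul measurable_id)
  have hm : ∀ i, Measurable (fun ω => c i * (s i).indicator (1 : Ω → ℝ) ω) := fun i =>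
    measurable_const.mul (measurable_one.indicator (hs i))
  have hint : Integrable
      (fun ω => Real.exp (1 * (∑ i, fun ω => c i * (s i).indicator (1 : Ω → ℝ) ω) ω)) P :=
    hX.integrable_exp_mul_sum hm (s := Finset.univ) (t := 1)
      (fun i _ => by simpa using integrable_exp_mul_indicator (hs i) (c i))
  have h := measure_ge_le_exp_mul_mgf τ (t := 1) zero_le_one hint
  rw [hX.mgf_sum hm Finset.univ] at h
  have h2 : ∏ i, mgf (fun ω => c i * (s i).indicator (1 : Ω → ℝ) ω) P 1 ≤
      Real.exp (∑ i, P.real (s i) * (Real.exp (c i) - 1)) := by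
    rw [Real.exp_sum]
    refine Finset.prod_le_prod (fun i _ => mgf_nonneg) (fun i _ => ?_)
    rw [mgf]
    simp only [one_mul]
    rw [integral_exp_mul_indicator (hs i), add_comm]
    exact Real.add_one_le_exp _
  rw [Real.exp_add]
  calc _ = P.real {ω | τ ≤ (∑ i, fun ω => c i * (s i).indicator (1 : Ω → ℝ) ω) ω} := by
        simp only [Finset.sum_apply]
    _ ≤ _ := h
    _ ≤ _ := by
        rw [neg_one_mul]
        exact mul_le_mul_of_nonneg_left h2 (Real.exp_pos _).le

/-- Chernoff bound for a nonnegative combination of independent indicators. -/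
lemma chernoff_indicator (hs : ∀ i, MeasurableSet (s i)) (hi : iIndepSet s P)
    {k : ι → ℝ} {w ν l : ℝ} (hw : 0 < w) (hk0 : ∀ i, 0 ≤ k i) (hkw : ∀ i, k i ≤ w)
    (hν : ∑ i, P.real (s i) * k i ≤ ν) (hl : 1 ≤ l) :
    P.real {ω | l * ν ≤ ∑ i, k i * (s i).indicator (1 : Ω → ℝ) ω} ≤
      Real.exp (-(ν / w * (l * Real.log l - l + 1))) := by
  have hl0 : 0 < l := by linarith
  set θ := Real.log l / w with hθ
  have hθ0 : 0 ≤ θ := div_nonneg (Real.log_nonneg hl) hw.le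
  have hsub : {ω | l * ν ≤ ∑ i, k i * (s i).indicator (1 : Ω → ℝ) ω} ⊆
      {ω | θ * (l * ν) ≤ ∑ i, (θ * k i) * (s i).indicator (1 : Ω → ℝ) ω} := by
    intro ω hω
    simp only [Set.mem_ofPred_eq, mul_assoc, ← Finset.mul_sum] at hω ⊢
    exact mul_le_mul_of_nonneg_left hω hθ0
  refine (measureReal_mono hsub).trans ((prob_le_sum_indicator hs hi _ _).trans ?_)
  apply Real.exp_le_exp.2
  -- The exponential lies below its chord on `[0, θw]`, whose right end has height `e^{θw} = l`;
  -- this reduces the exponential moments to the mean.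
  have hconv : ∀ i, Real.exp (θ * k i) - 1 ≤ k i / w * (l - 1) := by
    intro i
    have h := convexOn_exp.2 (Set.mem_univ 0) (Set.mem_univ (θ * w))
      (show 0 ≤ 1 - k i / w by rw [sub_nonneg, div_le_one hw]; exact hkw i)
      (show 0 ≤ k i / w from div_nonneg (hk0 i) hw.le) (by ring)
    have e1 : θ * w = Real.log l := by rw [hθ]; field_simp
    have e2 : k i / w * Real.log l = θ * k i := by rw [hθ]; ring
    simp only [smul_eq_mul, mul_zero, zero_add, Real.exp_zero, e1, e2, Real.exp_log hl0] at h
    linarith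
  have hsum : ∑ i, P.real (s i) * (Real.exp (θ * k i) - 1) ≤ ν / w * (l - 1) := by
    calc _ ≤ ∑ i, P.real (s i) * k i * ((l - 1) / w) := by
          refine Finset.sum_le_sum fun i _ => ?_
          have := mul_le_mul_of_nonneg_left (hconv i) (measureReal_nonneg (μ := P) (s := s i))
          calc _ ≤ _ := this
            _ = _ := by ring
      _ = (∑ i, P.real (s i) * k i) * ((l - 1) / w) := by rw [Finset.sum_mul]
      _ ≤ ν * ((l - 1) / w) :=
          mul_le_mul_of_nonneg_right hν (div_nonneg (by linarith) hw.le)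
      _ = _ := by ring
  have e3 : θ * (l * ν) = ν / w * (l * Real.log l) := by rw [hθ]; ring
  rw [e3]
  linarith [hsum]

/-- Bernstein-type bound for a centred combination of independent indicators. -/
lemma bernstein_indicator (hs : ∀ i, MeasurableSet (s i)) (hi : iIndepSet s P)
    {k : ι → ℝ} {b v : ℝ} (hb : 0 < b) (hk : ∀ i, |k i| ≤ b)
    (hv : ∑ i, P.real (s i) * k i ^ 2 ≤ v) (τ : ℝ) :
    P.real {ω | τ ≤ ∑ i, k i * ((s i).indicator (1 : Ω → ℝ) ω - P.real (s i))} ≤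
      Real.exp (-(τ / b) + v / b ^ 2) := by
  have hsub : {ω | τ ≤ ∑ i, k i * ((s i).indicator (1 : Ω → ℝ) ω - P.real (s i))} ⊆
      {ω | τ / b + ∑ i, k i / b * P.real (s i) ≤
        ∑ i, (k i / b) * (s i).indicator (1 : Ω → ℝ) ω} := by
    intro ω hω
    simp only [Set.mem_ofPred_eq] at hω ⊢
    rw [← le_sub_iff_add_le, ← Finset.sum_sub_distrib]
    have e : ∑ i, (k i / b * (s i).indicator (1 : Ω → ℝ) ω - k i / b * P.real (s i)) =
        (∑ i, k i * ((s i).indicator (1 : Ω → ℝ) ω - P.real (s i))) / b := by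
      rw [Finset.sum_div]
      exact Finset.sum_congr rfl fun i _ => by ring
    rw [e]
    gcongr
  refine (measureReal_mono hsub).trans ((prob_le_sum_indicator hs hi _ _).trans ?_)
  apply Real.exp_le_exp.2
  -- The tilt is fixed at `1 / b` rather than optimised, so that `|k i / b| ≤ 1` and `e^x - 1 - x ≤
  -- x²` applies.
  have hq : ∀ i, P.real (s i) * (Real.exp (k i / b) - 1) - k i / b * P.real (s i) ≤
      P.real (s i) * k i ^ 2 * (1 / b ^ 2) := by
    intro i
    have h1 : |k i / b| ≤ 1 := by
      rw [abs_div, abs_of_pos hb, div_le_one hb]; exact hk i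
    have h2 := (le_abs_self _).trans (Real.abs_exp_sub_one_sub_id_le h1)
    have h3 := mul_le_mul_of_nonneg_left h2 (measureReal_nonneg (μ := P) (s := s i))
    calc _ = P.real (s i) * (Real.exp (k i / b) - 1 - k i / b) := by ring
      _ ≤ _ := h3
      _ = _ := by ring
  have hsum := Finset.sum_le_sum fun i (_ : i ∈ Finset.univ) => hq i
  rw [Finset.sum_sub_distrib, ← Finset.sum_mul] at hsum
  have := mul_le_mul_of_nonneg_right hv (by positivity : 0 ≤ 1 / b ^ 2)
  have e : v / b ^ 2 = v * (1 / b ^ 2) := by ring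
  rw [e]
  linarith

lemma bernstein_indicator_abs (hs : ∀ i, MeasurableSet (s i)) (hi : iIndepSet s P)
    {k : ι → ℝ} {b v : ℝ} (hb : 0 < b) (hk : ∀ i, |k i| ≤ b)
    (hv : ∑ i, P.real (s i) * k i ^ 2 ≤ v) (τ : ℝ) :
    P.real {ω | τ ≤ |∑ i, k i * ((s i).indicator (1 : Ω → ℝ) ω - P.real (s i))|} ≤
      2 * Real.exp (-(τ / b) + v / b ^ 2) := by
  have h1 := bernstein_indicator hs hi hb hk hv τ
  have h2 := bernstein_indicator hs hi (k := fun i => -k i) hb (by simpa using hk)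
    (by simpa using hv) τ
  have hsub : {ω | τ ≤ |∑ i, k i * ((s i).indicator (1 : Ω → ℝ) ω - P.real (s i))|} ⊆
      {ω | τ ≤ ∑ i, k i * ((s i).indicator (1 : Ω → ℝ) ω - P.real (s i))} ∪
      {ω | τ ≤ ∑ i, -k i * ((s i).indicator (1 : Ω → ℝ) ω - P.real (s i))} := by
    intro ω hω
    simpa only [Set.mem_union, Set.mem_ofPred_eq, neg_mul, Finset.sum_neg_distrib, le_abs]
      using hω
  refine (measureReal_mono hsub).trans ((measureReal_union_le _ _).trans ?_)
  linarith

lemma exists_mul_log_eq {y : ℝ} (hy : 0 ≤ y) : ∃ l, 1 ≤ l ∧ l * Real.log l = y := by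
  have hcont : ContinuousOn (fun l : ℝ => l * Real.log l) (Set.Icc 1 (Real.exp 1 + y)) :=
    Real.continuous_mul_log.continuousOn
  have he : 1 ≤ Real.exp 1 := Real.one_le_exp zero_le_one
  have hlog : 1 ≤ Real.log (Real.exp 1 + y) := by
    rw [Real.le_log_iff_exp_le (by positivity)]; linarith
  have hmem : y ∈ Set.Icc ((1 : ℝ) * Real.log 1)
      ((Real.exp 1 + y) * Real.log (Real.exp 1 + y)) := by
    refine ⟨by simpa using hy, ?_⟩
    nlinarith
  obtain ⟨l, hl, h⟩ := intermediate_value_Icc (by linarith) hcont hmem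
  exact ⟨l, hl.1, h⟩

lemma mul_log_le_mul_log {a b : ℝ} (ha : 1 ≤ a) (hab : a ≤ b) :
    a * Real.log a ≤ b * Real.log b :=
  mul_le_mul hab (Real.log_le_log (by linarith) hab) (Real.log_nonneg ha) (by linarith)

/-- A Chernoff bound for the event that `S log (S / ν)` is large. -/
lemma prob_mul_log_gt_le (hs : ∀ i, MeasurableSet (s i)) (hi : iIndepSet s P)
    {k : ι → ℝ} {w ν T : ℝ} (hw : 0 < w) (hk0 : ∀ i, 0 ≤ k i) (hkw : ∀ i, k i ≤ w)
    (hν : ∑ i, P.real (s i) * k i ≤ ν) (hν0 : 0 < ν) (hT : 0 ≤ T) :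
    P.real {ω | Real.exp 2 * ν < ∑ i, k i * (s i).indicator (1 : Ω → ℝ) ω ∧
        T < (∑ i, k i * (s i).indicator (1 : Ω → ℝ) ω) *
          Real.log ((∑ i, k i * (s i).indicator (1 : Ω → ℝ) ω) / ν)} ≤
      Real.exp (-(T / (2 * w))) := by
  obtain ⟨l₀, hl₀, hl₀T⟩ := exists_mul_log_eq (div_nonneg hT hν0.le)
  -- The root `l₀` turns the condition on `S log (S / ν)` into `S ≥ l₀ν`. The floor `e²` forces `log
  -- l ≥ 2`, whence `l log l - l + 1 ≥ (l log l) / 2`; this is the 2 in the exponent.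
  set l := max l₀ (Real.exp 2) with hl
  have hl1 : 1 ≤ l := hl₀.trans (le_max_left _ _)
  have hlog2 : 2 ≤ Real.log l := by
    rw [Real.le_log_iff_exp_le (by linarith)]; exact le_max_right _ _
  have hlT : T / ν ≤ l * Real.log l := by
    rw [← hl₀T]; exact mul_log_le_mul_log hl₀ (le_max_left _ _)
  have hsub : {ω | Real.exp 2 * ν < ∑ i, k i * (s i).indicator (1 : Ω → ℝ) ω ∧
        T < (∑ i, k i * (s i).indicator (1 : Ω → ℝ) ω) *
          Real.log ((∑ i, k i * (s i).indicator (1 : Ω → ℝ) ω) / ν)} ⊆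
      {ω | l * ν ≤ ∑ i, k i * (s i).indicator (1 : Ω → ℝ) ω} := by
    intro ω ⟨h1, h2⟩
    set S := ∑ i, k i * (s i).indicator (1 : Ω → ℝ) ω
    change l * ν ≤ S
    rw [← le_div_iff₀ hν0]
    have h3 : Real.exp 2 < S / ν := by rwa [lt_div_iff₀ hν0]
    refine max_le ?_ h3.le
    by_contra! hlt
    have h4 := mul_log_le_mul_log ((Real.one_le_exp zero_le_two).trans h3.le) hlt.le
    rw [hl₀T, div_mul_eq_mul_div, div_le_div_iff_of_pos_right hν0] at h4
    linarith
  refine (measureReal_mono hsub).trans ((chernoff_indicator hs hi hw hk0 hkw hν hl1).trans ?_)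
  apply Real.exp_le_exp.2
  rw [neg_le_neg_iff]
  have h5 : l * Real.log l / 2 ≤ l * Real.log l - l + 1 := by nlinarith
  calc T / (2 * w) = ν / w * (T / ν / 2) := by field_simp
    _ ≤ ν / w * (l * Real.log l - l + 1) := by
        apply mul_le_mul_of_nonneg_left _ (div_nonneg hν0.le hw.le)
        linarith

end Tails

/-! ### A quarter-net of the unit ball -/

section Nets

open Module Metric

variable {E : Type*} [NormedAddCommGroup E] [NormedSpace ℝ E] [FiniteDimensional ℝ E]

/-- Volumetric bound for a quarter-separated subset of the unit ball. -/
lemma card_le_nine_pow_of_separated (s : Finset E) (hs : ∀ c ∈ s, ‖c‖ ≤ 1)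
    (h : ∀ c ∈ s, ∀ d ∈ s, c ≠ d → 1 / 4 ≤ ‖c - d‖) : s.card ≤ 9 ^ finrank ℝ E := by
  borelize E
  let μ : Measure E := Measure.addHaar
  -- Balls of radius 1/8 about the points are disjoint and lie in the ball of radius 9/8; the ratio
  -- of radii is 9.
  let δ : ℝ := (1 : ℝ) / 8
  let ρ : ℝ := (9 : ℝ) / 8
  have ρpos : 0 < ρ := by norm_num
  have δpos : 0 < δ := by norm_num
  set A := ⋃ c ∈ s, ball (c : E) δ with hA
  have D : Set.Pairwise (s : Set E) (Function.onFun Disjoint fun c => ball (c : E) δ) := by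
    rintro c hc d hd hcd
    apply ball_disjoint_ball
    rw [dist_eq_norm]
    have := h c hc d hd hcd
    norm_num [δ] at this ⊢
    linarith
  have A_subset : A ⊆ ball (0 : E) ρ := by
    refine Set.iUnion₂_subset fun x hx => ?_
    apply ball_subset_ball'
    have := hs x hx
    rw [dist_zero_right]
    norm_num [δ, ρ]
    linarith
  have I : (s.card : ENNReal) * ENNReal.ofReal (δ ^ finrank ℝ E) * μ (ball 0 1) ≤
      ENNReal.ofReal (ρ ^ finrank ℝ E) * μ (ball 0 1) :=
    calc
      (s.card : ENNReal) * ENNReal.ofReal (δ ^ finrank ℝ E) * μ (ball 0 1) = μ A := by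
        rw [hA, measure_biUnion_finset D fun c _ => measurableSet_ball]
        simp only [μ.addHaar_ball_of_pos _ δpos]
        simp only [Finset.sum_const, nsmul_eq_mul, mul_assoc]
      _ ≤ μ (ball (0 : E) ρ) := measure_mono A_subset
      _ = ENNReal.ofReal (ρ ^ finrank ℝ E) * μ (ball 0 1) := by
        simp only [μ.addHaar_ball_of_pos _ ρpos]
  have J : (s.card : ENNReal) * ENNReal.ofReal (δ ^ finrank ℝ E) ≤
      ENNReal.ofReal (ρ ^ finrank ℝ E) :=
    (ENNReal.mul_le_mul_iff_left (measure_ball_pos _ _ zero_lt_one).ne' measure_ball_lt_top.ne).1 I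
  have K : (s.card : ℝ) ≤ (9 : ℝ) ^ finrank ℝ E := by
    have := ENNReal.toReal_le_of_le_ofReal (pow_nonneg ρpos.le _) J
    simpa [ρ, δ, div_eq_mul_inv, mul_pow] using this
  exact mod_cast K

variable (E) in
/-- The unit ball has a quarter-net with at most `9 ^ dim` elements. -/
lemma exists_quarter_net : ∃ s : Finset E, s.card ≤ 9 ^ finrank ℝ E ∧ (∀ c ∈ s, ‖c‖ ≤ 1) ∧
    ∀ x : E, ‖x‖ ≤ 1 → ∃ c ∈ s, ‖x - c‖ ≤ 1 / 4 := by
  classical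
  let Q : ℕ → Prop := fun N => ∃ s : Finset E, s.card = N ∧ (∀ c ∈ s, ‖c‖ ≤ 1) ∧
    ∀ c ∈ s, ∀ d ∈ s, c ≠ d → 1 / 4 ≤ ‖c - d‖
  have hb : ∀ N, Q N → N ≤ 9 ^ finrank ℝ E := by
    rintro _ ⟨s, rfl, h1, h2⟩
    exact card_le_nine_pow_of_separated s h1 h2
  have h0 : Q 0 := ⟨∅, by simp⟩
  -- A separated set of maximal cardinality is a net, since an uncovered point could be added to it.
  obtain ⟨s, hsc, h1, h2⟩ := Nat.findGreatest_spec (Nat.zero_le _) h0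
  refine ⟨s, card_le_nine_pow_of_separated s h1 h2, h1, fun x hx => ?_⟩
  by_contra! hcon
  have hxs : x ∉ s := fun hx' => by
    have := hcon x hx'
    norm_num at this
  have hQ : Q (s.card + 1) := by
    refine ⟨insert x s, by simp [hxs], ?_, ?_⟩
    · intro c hc
      rcases Finset.mem_insert.1 hc with rfl | hc
      exacts [hx, h1 c hc]
    · intro c hc d hd hcd
      rcases Finset.mem_insert.1 hc with hc' | hc' <;> rcases Finset.mem_insert.1 hd with hd' | hd'
      · exact absurd (hc'.trans hd'.symm) hcd
      · rw [hc']; exact (hcon d hd').le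
      · rw [hd', norm_sub_rev]; exact (hcon c hc').le
      · exact h2 c hc' d hd' hcd
  have hle : s.card + 1 ≤ Nat.findGreatest Q (9 ^ finrank ℝ E) :=
    Nat.le_findGreatest (hb _ hQ) hQ
  rw [← hsc] at hle
  omega

end Nets

/-! ### From the net to the operator norm -/

section Rayleigh

variable {E : Type*} [NormedAddCommGroup E] [InnerProductSpace ℝ E]

/-- The norm of a symmetric operator is at most twice the maximum of its quadratic form over a
quarter-net of the unit ball. -/
lemma norm_le_of_net {T : E →L[ℝ] E} (hT : (T : E →ₗ[ℝ] E).IsSymmetric) {s : Finset E}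
    (hs1 : ∀ c ∈ s, ‖c‖ ≤ 1) (hs : ∀ x : E, ‖x‖ ≤ 1 → ∃ c ∈ s, ‖x - c‖ ≤ 1 / 4) {B : ℝ}
    (hB : ∀ c ∈ s, |inner ℝ c (T c)| ≤ B) : ‖T‖ ≤ 2 * B := by
  have hB0 : 0 ≤ B := by
    obtain ⟨c, hc, -⟩ := hs 0 (by simp)
    exact (abs_nonneg _).trans (hB c hc)
  -- Replacing `x` by a net point in each slot of the form costs `‖T‖ / 4`; the total `‖T‖ / 2` is
  -- absorbed on the left since the Rayleigh quotients determine `‖T‖`.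
  have key : ∀ x : E, ‖x‖ = 1 → |inner ℝ x (T x)| ≤ B + ‖T‖ / 2 := by
    intro x hx
    obtain ⟨c, hc, hxc⟩ := hs x hx.le
    have e : inner ℝ x (T x) = inner ℝ c (T c) + inner ℝ (x - c) (T x) +
        inner ℝ c (T (x - c)) := by
      simp only [map_sub, inner_sub_left, inner_sub_right]; ring
    have h1 : |inner ℝ (x - c) (T x)| ≤ ‖T‖ / 4 := by
      refine (abs_real_inner_le_norm _ _).trans ?_
      have := T.le_opNorm x
      rw [hx, mul_one] at this
      calc _ ≤ 1 / 4 * ‖T‖ := by gcongr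
        _ = _ := by ring
    have h2 : |inner ℝ c (T (x - c))| ≤ ‖T‖ / 4 := by
      refine (abs_real_inner_le_norm _ _).trans ?_
      have := (T.le_opNorm (x - c)).trans (mul_le_mul_of_nonneg_left hxc (norm_nonneg T))
      calc _ ≤ 1 * (‖T‖ * (1 / 4)) := by gcongr; exact hs1 c hc
        _ = _ := by ring
    rw [e]
    have h3 := abs_add_le (inner ℝ c (T c) + inner ℝ (x - c) (T x)) (inner ℝ c (T (x - c)))
    have h4 := abs_add_le (inner ℝ c (T c)) (inner ℝ (x - c) (T x))
    have h5 := hB c hc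
    linarith
  have h : ‖T‖ ≤ B + ‖T‖ / 2 := by
    conv_lhs => rw [ContinuousLinearMap.norm_eq_iSup_rayleighQuotient T hT]
    refine ciSup_le fun x => ?_
    rcases eq_or_ne x 0 with rfl | hx
    · simp only [ContinuousLinearMap.rayleighQuotient_apply_zero, abs_zero]; positivity
    · have hx' : ‖x‖⁻¹ ≠ 0 := inv_ne_zero (norm_ne_zero_iff.2 hx)
      have hn : ‖(‖x‖⁻¹) • x‖ = 1 := by
        rw [norm_smul, norm_inv, norm_norm, inv_mul_cancel₀ (norm_ne_zero_iff.2 hx)]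
      have h := key _ hn
      rw [← T.rayleigh_smul x hx', ContinuousLinearMap.rayleighQuotient, hn,
        ContinuousLinearMap.reApplyInnerSelf_apply]
      simpa [real_inner_comm] using h
  linarith

end Rayleigh

/-! ### Geometric sums over finite sets of integers -/

section GeometricSums

/-- Counted down from the largest exponent, the terms are dominated by a geometric series of ratio
`1 / q`. The bound is independent of the number of scales. -/
lemma sum_zpow_le {q : ℝ} (hq : 1 < q) (S : Finset ℤ) {a : ℝ} (ha : 0 ≤ a)
    (h : ∀ t ∈ S, q ^ t ≤ a) : ∑ t ∈ S, q ^ t ≤ a * (q / (q - 1)) := by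
  have hq0 : 0 < q := by linarith
  have hq1 : 0 < q - 1 := by linarith
  rcases S.eq_empty_or_nonempty with rfl | hS
  · simp only [Finset.sum_empty]; positivity
  set T := S.max' hS
  have hT : ∀ t ∈ S, t ≤ T := fun t ht => S.le_max' t ht
  have hinj : Set.InjOn (fun t : ℤ => (T - t).toNat) S := by
    intro t ht u hu htu
    have := hT t ht
    have := hT u hu
    simp only at htu
    omega
  have e1 : ∑ t ∈ S, q ^ t = q ^ T * ∑ k ∈ S.image (fun t => (T - t).toNat), (q⁻¹) ^ k := by
    rw [Finset.sum_image hinj, Finset.mul_sum]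
    refine Finset.sum_congr rfl fun t ht => ?_
    have h1 : ((T - t).toNat : ℤ) = T - t := Int.toNat_of_nonneg (by linarith [hT t ht])
    rw [← zpow_natCast, h1, inv_zpow, ← zpow_neg, ← zpow_add₀ hq0.ne']
    congr 1; ring
  have h2 : ∑ k ∈ S.image (fun t => (T - t).toNat), (q⁻¹) ^ k ≤ (1 - q⁻¹)⁻¹ := by
    have hlt : q⁻¹ < 1 := inv_lt_one_of_one_lt₀ hq
    rw [← tsum_geometric_of_lt_one (by positivity) hlt]
    exact (summable_geometric_of_lt_one (by positivity) hlt).sum_le_tsum _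
      (fun _ _ => by positivity)
  have e2 : (1 - q⁻¹)⁻¹ = q / (q - 1) := by field_simp
  rw [e1, ← e2]
  exact mul_le_mul (h T (S.max'_mem hS)) h2 (Finset.sum_nonneg fun _ _ => by positivity) ha

lemma sum_ite_zpow_le {q : ℝ} (hq : 1 < q) (S : Finset ℤ) (p : ℤ → Prop) [DecidablePred p]
    {a c : ℝ} (ha : 0 ≤ a) (hc : 0 ≤ c) (h : ∀ t ∈ S, p t → q ^ t ≤ a) :
    ∑ t ∈ S, (if p t then c * q ^ t else 0) ≤ c * (a * (q / (q - 1))) := by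
  rw [← Finset.sum_filter, ← Finset.mul_sum]
  refine mul_le_mul_of_nonneg_left (sum_zpow_le hq _ ha fun t ht => ?_) hc
  exact h t (Finset.mem_filter.1 ht).1 (Finset.mem_filter.1 ht).2

lemma sum_ite_zpow_inv_le {q : ℝ} (hq : 1 < q) (S : Finset ℤ) (p : ℤ → Prop) [DecidablePred p]
    {a c : ℝ} (ha : 0 ≤ a) (hc : 0 ≤ c) (h : ∀ t ∈ S, p t → (q ^ t)⁻¹ ≤ a) :
    ∑ t ∈ S, (if p t then c * (q ^ t)⁻¹ else 0) ≤ c * (a * (q / (q - 1))) := by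
  have := sum_ite_zpow_le hq (S.image Neg.neg) (fun t => p (-t)) ha hc (by
    intro t ht hp
    obtain ⟨u, hu, rfl⟩ := Finset.mem_image.1 ht
    rw [neg_neg] at hp
    rw [zpow_neg]
    exact h u hu hp)
  rw [Finset.sum_image (fun _ _ _ _ h => neg_injective h)] at this
  simpa only [neg_neg, zpow_neg] using this

end GeometricSums

/-! ### The deterministic estimate over pairs of dyadic scales -/

section HeavyPairs

/-- Pointwise estimate behind the bound for heavy pairs of dyadic classes, where `X = 2 ^ s` and
`Y = y ^ 2 = 2 ^ t` are the levels, `N ≤ N'` the sizes, and `E` the edge count of two classes. -/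
lemma heavy_term_le {n r D C₂ X y N N' E : ℝ} (hn : 0 < n) (hr : 0 < r) (hD : 0 ≤ D)
    (hC₂ : 0 ≤ C₂) (hX : 0 < X) (hy : 0 < y) (hN : 0 < N) (hN' : 0 < N')
    (hβ : N' * (y ^ 2) ^ 2 ≤ n) (hE : 0 ≤ E) (hdeg₁ : E ≤ D * r ^ 2 * N)
    (hdeg₂ : E ≤ D * r ^ 2 * N')
    (hdisc : E ≤ Real.exp 2 * (r ^ 2 / n * N * N') ∨
      E * Real.log (E / (r ^ 2 / n * N * N')) ≤ C₂ * (N' * Real.log (Real.exp 1 * n / N')))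
    (hheavy : r ≤ X * y ^ 2) :
    X * y ^ 2 / n * E ≤
      Real.exp 2 * r * (N * X ^ 2 / n) * (N' * (y ^ 2) ^ 2 / n) +
      (if r * y ^ 2 < X then D * r ^ 2 * (N * X ^ 2 / n) / X * y ^ 2 else 0) +
      (if r * X < y ^ 2 then D * r ^ 2 * (N' * (y ^ 2) ^ 2 / n) / y ^ 2 * X else 0) +
      (if X ≤ r * y ^ 2 then 4 * C₂ * (N' * (y ^ 2) ^ 2 / n) / y ^ 2 * X else 0) +
      (if r ≤ X * y ^ 2 ∧ r ≤ X then 4 / 3 * r ^ 2 * (N * X ^ 2 / n) / X * y⁻¹ else 0) +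
      (if r ≤ X * y ^ 2 ∧ X < r then 8 / 3 * C₂ * X * y⁻¹ else 0) := by
  have g1 : 0 ≤ Real.exp 2 * r * (N * X ^ 2 / n) * (N' * (y ^ 2) ^ 2 / n) := by positivity
  have g2 : 0 ≤ (if r * y ^ 2 < X then D * r ^ 2 * (N * X ^ 2 / n) / X * y ^ 2 else 0) := by
    split_ifs <;> positivity
  have g3 : 0 ≤ (if r * X < y ^ 2 then
      D * r ^ 2 * (N' * (y ^ 2) ^ 2 / n) / y ^ 2 * X else 0) := by
    split_ifs <;> positivity
  have g4 : 0 ≤ (if X ≤ r * y ^ 2 then 4 * C₂ * (N' * (y ^ 2) ^ 2 / n) / y ^ 2 * X else 0) := by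
    split_ifs <;> positivity
  have g5 : 0 ≤ (if r ≤ X * y ^ 2 ∧ r ≤ X then
      4 / 3 * r ^ 2 * (N * X ^ 2 / n) / X * y⁻¹ else 0) := by
    split_ifs <;> positivity
  have g6 : 0 ≤ (if r ≤ X * y ^ 2 ∧ X < r then 8 / 3 * C₂ * X * y⁻¹ else 0) := by
    split_ifs <;> positivity
  have hXn : 0 ≤ X * y ^ 2 / n := by positivity
  -- If one level exceeds `r` times the other, the degree bound suffices: the sum over the smaller
  -- level is geometric.
  by_cases hb1 : r * y ^ 2 < X
  · have : X * y ^ 2 / n * E ≤ D * r ^ 2 * (N * X ^ 2 / n) / X * y ^ 2 := by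
      calc _ ≤ X * y ^ 2 / n * (D * r ^ 2 * N) := mul_le_mul_of_nonneg_left hdeg₁ hXn
        _ = _ := by field_simp
    rw [if_pos hb1] at g2 ⊢
    linarith
  by_cases hb2 : r * X < y ^ 2
  · have : X * y ^ 2 / n * E ≤ D * r ^ 2 * (N' * (y ^ 2) ^ 2 / n) / y ^ 2 * X := by
      calc _ ≤ X * y ^ 2 / n * (D * r ^ 2 * N') := mul_le_mul_of_nonneg_left hdeg₂ hXn
        _ = _ := by field_simp
    rw [if_pos hb2] at g3 ⊢
    linarith
  have hb1' := not_lt.1 hb1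
  set ν := r ^ 2 / n * N * N' with hν
  have hν0 : 0 < ν := by positivity
  -- Edge count of the expected order: one factor `r` of `ν` is traded for `X * y ^ 2` by heaviness.
  by_cases ha : E ≤ Real.exp 2 * ν
  · have : X * y ^ 2 / n * E ≤
        Real.exp 2 * r * (N * X ^ 2 / n) * (N' * (y ^ 2) ^ 2 / n) := by
      calc _ ≤ X * y ^ 2 / n * (Real.exp 2 * ν) := mul_le_mul_of_nonneg_left ha hXn
        _ = Real.exp 2 * r * (N * X / n) * (N' * y ^ 2 / n) * r := by rw [hν]; field_simp
        _ ≤ Real.exp 2 * r * (N * X / n) * (N' * y ^ 2 / n) * (X * y ^ 2) := by gcongr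
        _ = _ := by ring
    linarith
  have hdisc' := hdisc.resolve_left ha
  have hl : Real.exp 2 < E / ν := by rw [lt_div_iff₀ hν0]; exact not_le.1 ha
  have hl0 : 0 < E / ν := (Real.exp_pos _).trans hl
  have hlog : 2 ≤ Real.log (E / ν) := by
    rw [Real.le_log_iff_exp_le hl0]; exact hl.le
  set z := Real.exp 1 * n / N' with hz
  have hz0 : 0 < z := by positivity
  -- The fourth root of `z` is the threshold for the ratio `E / ν`: above it, `log (E / ν)` is at
  -- least a quarter of the entropy `log z`.
  set ρ := Real.sqrt (Real.sqrt z) with hρ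
  have hρ0 : 0 < ρ := by positivity
  have hρ4 : ρ ^ 4 = z := by
    calc ρ ^ 4 = (ρ ^ 2) ^ 2 := by ring
      _ = z := by rw [hρ, Real.sq_sqrt (by positivity), Real.sq_sqrt hz0.le]
  have hL : Real.log z = 4 * Real.log ρ := by rw [← hρ4, Real.log_pow]; norm_num
  -- With `β = N' y⁴ / n ≤ 1` one has `β z = e y⁴`, so `(βρ)⁴ = β³ e y⁴ ≤ e y⁴`, and `e < (4/3)⁴`.
  -- The surviving factor `y`, the square root of the level, leaves a decaying `y⁻¹` in the last two
  -- cases.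
  have hβρ : N' * (y ^ 2) ^ 2 / n * ρ ≤ 4 / 3 * y := by
    have hβ1 : N' * (y ^ 2) ^ 2 / n ≤ 1 := by rw [div_le_one hn]; exact hβ
    have h4 : (N' * (y ^ 2) ^ 2 / n * ρ) ^ 4 ≤ (4 / 3 * y) ^ 4 := by
      calc _ = (N' * (y ^ 2) ^ 2 / n) ^ 3 * (Real.exp 1 * y ^ 4) := by
            rw [mul_pow, hρ4, hz]; field_simp
        _ ≤ 1 ^ 3 * (2.7182818286 * y ^ 4) := by
            gcongr
            exact Real.exp_one_lt_d9.le
        _ ≤ _ := by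
            have : 0 < y ^ 4 := by positivity
            ring_nf
            nlinarith
    exact le_of_pow_le_pow_left₀ (by norm_num) (by positivity) h4
  by_cases hc : ρ ≤ E / ν
  · have hlρ := Real.log_le_log hρ0 hc
    have hE4 : E ≤ 4 * C₂ * N' := by
      have h1 : E * Real.log (E / ν) ≤ 4 * C₂ * N' * Real.log (E / ν) := by
        refine hdisc'.trans ?_
        rw [hL]
        have : 0 ≤ C₂ * N' := by positivity
        nlinarith
      exact le_of_mul_le_mul_right h1 (by linarith)
    have : X * y ^ 2 / n * E ≤ 4 * C₂ * (N' * (y ^ 2) ^ 2 / n) / y ^ 2 * X := by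
      calc _ ≤ X * y ^ 2 / n * (4 * C₂ * N') := mul_le_mul_of_nonneg_left hE4 hXn
        _ = _ := by field_simp
    rw [if_pos hb1'] at g4 ⊢
    linarith
  have hc' : E ≤ ρ * ν := by
    rw [← div_le_iff₀ hν0]; exact (not_le.1 hc).le
  -- Small ratio: use `E ≤ ρν` directly if `X` is at least `r`; otherwise combine discrepancy with
  -- `log (E / ν) ≥ 2` and `log ρ ≤ ρ`.
  by_cases hd : r ≤ X
  · have : X * y ^ 2 / n * E ≤ 4 / 3 * r ^ 2 * (N * X ^ 2 / n) / X * y⁻¹ := by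
      calc _ ≤ X * y ^ 2 / n * (ρ * ν) := mul_le_mul_of_nonneg_left hc' hXn
        _ = r ^ 2 * (N * X ^ 2 / n) / (X * y ^ 2) * (N' * (y ^ 2) ^ 2 / n * ρ) := by
            rw [hν]; field_simp
        _ ≤ r ^ 2 * (N * X ^ 2 / n) / (X * y ^ 2) * (4 / 3 * y) := by gcongr
        _ = _ := by field_simp
    rw [if_pos (show r ≤ X * y ^ 2 ∧ r ≤ X from ⟨hheavy, hd⟩)] at g5 ⊢
    linarith
  · have hlogρ : Real.log ρ ≤ ρ := by linarith [Real.log_le_sub_one_of_pos hρ0]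
    have h2E : E ≤ 2 * C₂ * (N' * ρ) := by
      have h1 : E * 2 ≤ E * Real.log (E / ν) := mul_le_mul_of_nonneg_left hlog hE
      rw [hL] at hdisc'
      have : C₂ * (N' * (4 * Real.log ρ)) ≤ C₂ * (N' * (4 * ρ)) := by gcongr
      linarith
    have : X * y ^ 2 / n * E ≤ 8 / 3 * C₂ * X * y⁻¹ := by
      calc _ ≤ X * y ^ 2 / n * (2 * C₂ * (N' * ρ)) := mul_le_mul_of_nonneg_left h2E hXn
        _ = 2 * C₂ * (X / y ^ 2) * (N' * (y ^ 2) ^ 2 / n * ρ) := by field_simp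
        _ ≤ 2 * C₂ * (X / y ^ 2) * (4 / 3 * y) := by gcongr
        _ = _ := by field_simp; ring
    rw [if_pos (show r ≤ X * y ^ 2 ∧ X < r from ⟨hheavy, not_le.1 hd⟩)] at g6 ⊢
    linarith

/-- The Kahn–Szemerédi estimate for heavy pairs of dyadic classes. -/
lemma heavy_dyadic_sum_le {S : Finset ℤ} {N : ℤ → ℝ} {E : ℤ → ℤ → ℝ} {n r D C₂ : ℝ}
    (hn : 0 < n) (hr : 0 < r) (hD : 0 ≤ D) (hC₂ : 0 ≤ C₂) (hN : ∀ s ∈ S, 0 < N s)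
    (hα : ∑ s ∈ S, N s * ((2 : ℝ) ^ s) ^ 2 ≤ n) (hE : ∀ s ∈ S, ∀ t ∈ S, 0 ≤ E s t)
    (hdeg₁ : ∀ s ∈ S, ∀ t ∈ S, E s t ≤ D * r ^ 2 * N s)
    (hdeg₂ : ∀ s ∈ S, ∀ t ∈ S, E s t ≤ D * r ^ 2 * N t)
    (hdisc : ∀ s ∈ S, ∀ t ∈ S, N s ≤ N t → E s t ≤ Real.exp 2 * (r ^ 2 / n * N s * N t) ∨
      E s t * Real.log (E s t / (r ^ 2 / n * N s * N t)) ≤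
        C₂ * (N t * Real.log (Real.exp 1 * n / N t))) :
    ∑ s ∈ S, ∑ t ∈ S, (if N s ≤ N t ∧ r ≤ (2 : ℝ) ^ s * 2 ^ t then
      (2 : ℝ) ^ s * 2 ^ t / n * E s t else 0) ≤ r * (13 + 4 * D + 27 * C₂) := by
  set q := Real.sqrt 2 with hq
  have hq2 : q ^ 2 = 2 := Real.sq_sqrt (by norm_num)
  have hq0 : 0 < q := by positivity
  have hq14 : 1.4 ≤ q := Real.le_sqrt_of_sq_le (by norm_num)
  have hq1 : 1 < q := by linarith
  have hqq : q / (q - 1) ≤ 3.5 := by rw [div_le_iff₀ (by linarith)]; linarith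
  have hqt : ∀ t : ℤ, (q ^ t) ^ 2 = (2 : ℝ) ^ t := fun t => by
    rw [← hq2, ← zpow_natCast, ← zpow_natCast, ← zpow_mul, ← zpow_mul, mul_comm]
  have h2pos : ∀ t : ℤ, 0 < (2 : ℝ) ^ t := fun t => by positivity
  have hqpos : ∀ t : ℤ, 0 < q ^ t := fun t => by positivity
  -- The share of the squared norm carried by each class; total mass at most 1 makes the remaining
  -- outer sums harmless.
  set α : ℤ → ℝ := fun s => N s * ((2 : ℝ) ^ s) ^ 2 / n with hαdef
  have hα0 : ∀ s ∈ S, 0 ≤ α s := fun s hs => by have := hN s hs; positivity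
  have hα1 : ∑ s ∈ S, α s ≤ 1 := by
    rw [hαdef, ← Finset.sum_div, div_le_one hn]; exact hα
  have hterm : ∀ s ∈ S, ∀ t ∈ S, (if N s ≤ N t ∧ r ≤ (2 : ℝ) ^ s * 2 ^ t then
      (2 : ℝ) ^ s * 2 ^ t / n * E s t else 0) ≤
      Real.exp 2 * r * α s * α t +
      (if r * 2 ^ t < (2 : ℝ) ^ s then D * r ^ 2 * α s / 2 ^ s * 2 ^ t else 0) +
      (if r * 2 ^ s < (2 : ℝ) ^ t then D * r ^ 2 * α t / 2 ^ t * 2 ^ s else 0) +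
      (if (2 : ℝ) ^ s ≤ r * 2 ^ t then 4 * C₂ * α t / 2 ^ t * 2 ^ s else 0) +
      (if r ≤ (2 : ℝ) ^ s * 2 ^ t ∧ r ≤ (2 : ℝ) ^ s then
        4 / 3 * r ^ 2 * α s / 2 ^ s * (q ^ t)⁻¹ else 0) +
      (if r ≤ (2 : ℝ) ^ s * 2 ^ t ∧ (2 : ℝ) ^ s < r then
        8 / 3 * C₂ * 2 ^ s * (q ^ t)⁻¹ else 0) := by
    intro s hs t ht
    have hs0 := h2pos s
    have ht0 := h2pos t
    have hNs := hN s hs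
    have hNt := hN t ht
    have hαs := hα0 s hs
    have hαt := hα0 t ht
    have hqt0 := hqpos t
    by_cases h : N s ≤ N t ∧ r ≤ (2 : ℝ) ^ s * 2 ^ t
    · have := heavy_term_le hn hr hD hC₂ hs0 hqt0 hNs hNt (by
          rw [hqt]
          exact (Finset.single_le_sum (f := fun s => N s * ((2 : ℝ) ^ s) ^ 2)
            (fun u hu => by have := hN u hu; positivity) ht).trans hα)
        (hE s hs t ht) (hdeg₁ s hs t ht) (hdeg₂ s hs t ht) (hdisc s hs t ht h.1)
        (by rw [hqt]; exact h.2)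
      simp only [hqt] at this
      rw [if_pos h]
      exact this
    · rw [if_neg h]
      positivity
  refine (Finset.sum_le_sum fun s hs => Finset.sum_le_sum fun t ht => hterm s hs t ht).trans ?_
  simp only [Finset.sum_add_distrib]
  have s1 : ∑ s ∈ S, ∑ t ∈ S, Real.exp 2 * r * α s * α t ≤ 8 * r := by
    have : ∑ s ∈ S, ∑ t ∈ S, Real.exp 2 * r * α s * α t =
        Real.exp 2 * r * ((∑ s ∈ S, α s) * ∑ t ∈ S, α t) := by
      rw [Finset.sum_mul_sum, Finset.mul_sum]
      simp only [Finset.mul_sum, mul_assoc]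
    rw [this]
    have he : Real.exp 2 ≤ 8 := by
      have : Real.exp 2 = Real.exp 1 ^ 2 := by rw [← Real.exp_nat_mul]; norm_num
      rw [this]
      have := Real.exp_one_lt_d9
      have := Real.exp_pos 1
      nlinarith
    have h0 : 0 ≤ ∑ s ∈ S, α s := Finset.sum_nonneg hα0
    calc _ ≤ 8 * r * (1 * 1) := by gcongr
      _ = _ := by ring
  have two : (2 : ℝ) / (2 - 1) = 2 := by norm_num
  have sum_α : ∀ c : ℝ, 0 ≤ c → ∀ f : ℤ → ℝ, (∀ s ∈ S, f s ≤ c * α s) → ∑ s ∈ S, f s ≤ c := by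
    intro c hc f hf
    calc _ ≤ ∑ s ∈ S, c * α s := Finset.sum_le_sum hf
      _ = c * ∑ s ∈ S, α s := by rw [Finset.mul_sum]
      _ ≤ c * 1 := by gcongr
      _ = c := mul_one c
  have s2 : ∑ s ∈ S, ∑ t ∈ S, (if r * 2 ^ t < (2 : ℝ) ^ s then
      D * r ^ 2 * α s / 2 ^ s * 2 ^ t else 0) ≤ 2 * D * r := by
    refine sum_α _ (by positivity) _ fun s hs => ?_
    have hs0 := h2pos s
    have := hα0 s hs
    refine (sum_ite_zpow_le one_lt_two S _ (a := 2 ^ s / r) (by positivity) (by positivity)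
      (fun t _ h => ?_)).trans_eq ?_
    · rw [le_div_iff₀ hr]; linarith
    · rw [two]; field_simp
  have s3 : ∑ s ∈ S, ∑ t ∈ S, (if r * 2 ^ s < (2 : ℝ) ^ t then
      D * r ^ 2 * α t / 2 ^ t * 2 ^ s else 0) ≤ 2 * D * r := by
    rw [Finset.sum_comm]; exact s2
  have s4 : ∑ s ∈ S, ∑ t ∈ S, (if (2 : ℝ) ^ s ≤ r * 2 ^ t then
      4 * C₂ * α t / 2 ^ t * 2 ^ s else 0) ≤ 8 * C₂ * r := by
    rw [Finset.sum_comm]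
    refine sum_α _ (by positivity) _ fun s hs => ?_
    have hs0 := h2pos s
    have := hα0 s hs
    refine (sum_ite_zpow_le one_lt_two S _ (a := r * 2 ^ s) (by positivity) (by positivity)
      (fun t _ h => h)).trans_eq ?_
    rw [two]; field_simp; ring
  have s5 : ∑ s ∈ S, ∑ t ∈ S, (if r ≤ (2 : ℝ) ^ s * 2 ^ t ∧ r ≤ (2 : ℝ) ^ s then
        4 / 3 * r ^ 2 * α s / 2 ^ s * (q ^ t)⁻¹ else 0) ≤ 14 / 3 * r := by
    refine sum_α _ (by positivity) _ fun s hs => ?_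
    have hs0 := h2pos s
    have := hα0 s hs
    refine (sum_ite_zpow_inv_le hq1 S _ (a := 2 ^ s / r) (by positivity) (by positivity)
      (fun t _ h => ?_)).trans ?_
    · have ht := hqpos t
      rw [← hqt t] at h
      rw [inv_le_iff_one_le_mul₀ ht, div_mul_eq_mul_div, le_div_iff₀ hr, one_mul]
      refine le_of_pow_le_pow_left₀ two_ne_zero (by positivity) ?_
      -- Multiplying `r ≤ 2^s` by `r ≤ 2^s (q^t)²` and taking roots gives `r ≤ 2^s q^t`.
      calc r ^ 2 = r * r := sq r
        _ ≤ 2 ^ s * (2 ^ s * (q ^ t) ^ 2) := by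
            exact mul_le_mul h.2 h.1 hr.le hs0.le
        _ = _ := by ring
    · calc _ ≤ 4 / 3 * r ^ 2 * α s / 2 ^ s * (2 ^ s / r * 3.5) := by gcongr
        _ = _ := by field_simp; ring
  have s6 : ∑ s ∈ S, ∑ t ∈ S, (if r ≤ (2 : ℝ) ^ s * 2 ^ t ∧ (2 : ℝ) ^ s < r then
        8 / 3 * C₂ * 2 ^ s * (q ^ t)⁻¹ else 0) ≤ 56 / 3 * C₂ * r := by
    have hs : ∀ s ∈ S, ∑ t ∈ S, (if r ≤ (2 : ℝ) ^ s * 2 ^ t ∧ (2 : ℝ) ^ s < r then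
        8 / 3 * C₂ * 2 ^ s * (q ^ t)⁻¹ else 0) ≤
        if (2 : ℝ) ^ s < r then 28 / 3 * C₂ * 2 ^ s else 0 := by
      intro s _
      have hs0 := h2pos s
      split_ifs with hsr
      · refine (sum_ite_zpow_inv_le hq1 S _ (a := 1) (by positivity) (by positivity)
          (fun t _ h => ?_)).trans ?_
        · have ht := hqpos t
          rw [← hqt t] at h
          apply inv_le_one_of_one_le₀
          by_contra! hlt
          have h1 : (q ^ t) ^ 2 ≤ 1 := by nlinarith
          have h2 : 2 ^ s * (q ^ t) ^ 2 ≤ 2 ^ s * 1 := mul_le_mul_of_nonneg_left h1 hs0.le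
          linarith [h.1]
        · calc _ ≤ 8 / 3 * C₂ * 2 ^ s * (1 * 3.5) := by gcongr
            _ = _ := by ring
      · simp [hsr]
    refine (Finset.sum_le_sum hs).trans ?_
    refine (sum_ite_zpow_le one_lt_two S _ (a := r) hr.le (by positivity)
      (fun t _ h => h.le)).trans_eq ?_
    rw [two]; ring
  -- The six sums add up: `8 + 14/3 ≤ 13`, `2 + 2 = 4` for `D`, and `8 + 56/3 ≤ 27` for `C₂`.
  nlinarith [mul_nonneg hC₂ hr.le]

end HeavyPairs

/-! ### Dyadic classes of coordinates and the heavy part of the form -/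

section HeavyMatrix

variable {n : ℕ}

/-- The dyadic level of the `i`-th coordinate of `x`, normalised by `√n`. -/
noncomputable def dyadicLevel (x : Fin n → ℝ) (i : Fin n) : ℤ := Int.log 2 (Real.sqrt n * |x i|)

/-- The pairs of coordinates of `x` whose product is large, up to dyadic rounding. -/
def IsHeavyPair (r : ℝ) (x : Fin n → ℝ) (i j : Fin n) : Prop :=
  x i ≠ 0 ∧ x j ≠ 0 ∧ r ≤ (2 : ℝ) ^ dyadicLevel x i * 2 ^ dyadicLevel x j

lemma two_zpow_dyadicLevel_le (hn : 0 < n) (x : Fin n → ℝ) {i : Fin n} (hi : x i ≠ 0) :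
    (2 : ℝ) ^ dyadicLevel x i ≤ Real.sqrt n * |x i| := by
  have hn' : 0 < Real.sqrt n := Real.sqrt_pos.2 (by exact_mod_cast hn)
  exact_mod_cast Int.zpow_log_le_self (b := 2) one_lt_two (mul_pos hn' (abs_pos.2 hi))

lemma lt_two_mul_two_zpow_dyadicLevel (x : Fin n → ℝ) (i : Fin n) :
    Real.sqrt n * |x i| < 2 * (2 : ℝ) ^ dyadicLevel x i := by
  have h := Int.lt_zpow_succ_log_self (b := 2) one_lt_two (Real.sqrt n * |x i|)
  rw [zpow_add_one₀ (by norm_num)] at h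
  rw [mul_comm 2]
  exact_mod_cast h

lemma IsHeavyPair.le_mul {r : ℝ} {x : Fin n → ℝ} {i j : Fin n} (h : IsHeavyPair r x i j) :
    r ≤ n * (|x i| * |x j|) := by
  have hn : 0 < n := i.pos
  calc r ≤ (2 : ℝ) ^ dyadicLevel x i * 2 ^ dyadicLevel x j := h.2.2
    _ ≤ (Real.sqrt n * |x i|) * (Real.sqrt n * |x j|) :=
        mul_le_mul (two_zpow_dyadicLevel_le hn x h.1) (two_zpow_dyadicLevel_le hn x h.2.1)
          (by positivity) (by positivity)
    _ = (Real.sqrt n * Real.sqrt n) * (|x i| * |x j|) := by ring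
    _ = _ := by rw [Real.mul_self_sqrt (Nat.cast_nonneg n)]

/-- Each dyadic rounding loses a factor below 2, hence the 4. -/
lemma mul_le_of_not_isHeavyPair {r : ℝ} (hr : 0 ≤ r) {x : Fin n → ℝ} {i j : Fin n}
    (h : ¬IsHeavyPair r x i j) : n * (|x i| * |x j|) ≤ 4 * r := by
  by_cases hi : x i = 0
  · simp [hi, hr]
  by_cases hj : x j = 0
  · simp [hj, hr]
  have h' : (2 : ℝ) ^ dyadicLevel x i * 2 ^ dyadicLevel x j < r := by
    by_contra! hc
    exact h ⟨hi, hj, hc⟩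
  calc (n : ℝ) * (|x i| * |x j|) = (Real.sqrt n * Real.sqrt n) * (|x i| * |x j|) := by
        rw [Real.mul_self_sqrt (Nat.cast_nonneg n)]
    _ = (Real.sqrt n * |x i|) * (Real.sqrt n * |x j|) := by ring
    _ ≤ (2 * (2 : ℝ) ^ dyadicLevel x i) * (2 * 2 ^ dyadicLevel x j) :=
        mul_le_mul (lt_two_mul_two_zpow_dyadicLevel x i).le
          (lt_two_mul_two_zpow_dyadicLevel x j).le (by positivity) (by positivity)
    _ = 4 * ((2 : ℝ) ^ dyadicLevel x i * 2 ^ dyadicLevel x j) := by ring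
    _ ≤ _ := by linarith

lemma ite_le_ite_and_add_ite_and (a b : ℝ) {f : ℝ} (hf : 0 ≤ f) (p : Prop) [Decidable p] :
    (if p then f else 0) ≤ (if a ≤ b ∧ p then f else 0) + (if b ≤ a ∧ p then f else 0) := by
  by_cases hp : p
  · rcases le_total a b with h | h
    · rw [if_pos hp, if_pos (show a ≤ b ∧ p from ⟨h, hp⟩)]
      exact le_add_of_nonneg_right (by positivity)
    · rw [if_pos hp, if_pos (show b ≤ a ∧ p from ⟨h, hp⟩)]
      exact le_add_of_nonneg_left (by positivity)
  · simp [hp]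

open Classical in
/-- The contribution of heavy pairs to the quadratic form of a symmetric nonnegative matrix with
bounded row sums and the discrepancy property. -/
lemma heavy_sum_le (hn : 0 < n) {A : Fin n → Fin n → ℝ} {x : Fin n → ℝ} {r D C₂ : ℝ}
    (hr : 0 < r) (hD : 0 ≤ D) (hC₂ : 0 ≤ C₂) (hA : ∀ i j, 0 ≤ A i j)
    (hsymm : ∀ i j, A i j = A j i) (hx : ∑ i, x i ^ 2 ≤ 1)
    (hdeg : ∀ i, ∑ j, A i j ≤ D * r ^ 2)
    (hdisc : ∀ I J : Finset (Fin n), I.Nonempty → J.Nonempty → I.card ≤ J.card →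
      ∑ i ∈ I, ∑ j ∈ J, A i j ≤ Real.exp 2 * (r ^ 2 / n * I.card * J.card) ∨
      (∑ i ∈ I, ∑ j ∈ J, A i j) *
          Real.log ((∑ i ∈ I, ∑ j ∈ J, A i j) / (r ^ 2 / n * I.card * J.card)) ≤
        C₂ * (J.card * Real.log (Real.exp 1 * n / J.card))) :
    ∑ i, ∑ j, (if IsHeavyPair r x i j then |x i| * |x j| * A i j else 0) ≤
      8 * (r * (13 + 4 * D + 27 * C₂)) := by
  have hn' : (0 : ℝ) < n := by exact_mod_cast hn
  set V : Finset (Fin n) := Finset.univ.filter fun i => x i ≠ 0 with hV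
  set S : Finset ℤ := V.image (dyadicLevel x) with hS
  set I : ℤ → Finset (Fin n) := fun s => V.filter fun i => dyadicLevel x i = s with hI
  set N : ℤ → ℝ := fun s => ((I s).card : ℝ) with hN
  set E : ℤ → ℤ → ℝ := fun s t => ∑ i ∈ I s, ∑ j ∈ I t, A i j with hE
  have hmaps : ∀ i ∈ V, dyadicLevel x i ∈ S := fun i hi => Finset.mem_image_of_mem _ hi
  have hne : ∀ s ∈ S, (I s).Nonempty := by
    intro s hs
    obtain ⟨i, hi, rfl⟩ := Finset.mem_image.1 hs
    exact ⟨i, Finset.mem_filter.2 ⟨hi, rfl⟩⟩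
  have hEsymm : ∀ s t, E s t = E t s := by
    intro s t
    simp only [hE]
    rw [Finset.sum_comm]
    exact Finset.sum_congr rfl fun i _ => Finset.sum_congr rfl fun j _ => hsymm _ _
  have hdeg₁ : ∀ s t, E s t ≤ D * r ^ 2 * N s := by
    intro s t
    calc E s t ≤ ∑ i ∈ I s, D * r ^ 2 := Finset.sum_le_sum fun i _ =>
          (Finset.sum_le_sum_of_subset_of_nonneg (Finset.subset_univ _)
            fun j _ _ => hA i j).trans (hdeg i)
      _ = _ := by rw [Finset.sum_const, nsmul_eq_mul, mul_comm]
  have hα : ∑ s ∈ S, N s * ((2 : ℝ) ^ s) ^ 2 ≤ n := by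
    have h1 : ∀ s ∈ S, N s * ((2 : ℝ) ^ s) ^ 2 =
        ∑ i ∈ V with dyadicLevel x i = s, ((2 : ℝ) ^ dyadicLevel x i) ^ 2 := by
      intro s _
      rw [Finset.sum_congr rfl (g := fun _ => ((2 : ℝ) ^ s) ^ 2)
        (fun i hi => by rw [(Finset.mem_filter.1 hi).2]), Finset.sum_const, nsmul_eq_mul]
    rw [Finset.sum_congr rfl h1, Finset.sum_fiberwise_of_maps_to hmaps]
    calc ∑ i ∈ V, ((2 : ℝ) ^ dyadicLevel x i) ^ 2 ≤ ∑ i ∈ V, n * x i ^ 2 := by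
          refine Finset.sum_le_sum fun i hi => ?_
          have := two_zpow_dyadicLevel_le hn x (Finset.mem_filter.1 hi).2
          calc _ ≤ (Real.sqrt n * |x i|) ^ 2 := by gcongr
            _ = _ := by rw [mul_pow, Real.sq_sqrt hn'.le, sq_abs]
      _ ≤ ∑ i, n * x i ^ 2 := Finset.sum_le_sum_of_subset_of_nonneg (Finset.subset_univ _)
          fun i _ _ => by positivity
      _ = n * ∑ i, x i ^ 2 := by rw [Finset.mul_sum]
      _ ≤ n * 1 := by gcongr
      _ = n := mul_one _
  have hmain := heavy_dyadic_sum_le (S := S) (N := N) (E := E) hn' hr hD hC₂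
    (fun s hs => Nat.cast_pos.2 (hne s hs).card_pos) hα
    (fun s _ t _ => Finset.sum_nonneg fun i _ => Finset.sum_nonneg fun j _ => hA i j)
    (fun s _ t _ => hdeg₁ s t) (fun s _ t _ => by rw [hEsymm]; exact hdeg₁ t s)
    (fun s hs t ht hst => hdisc (I s) (I t) (hne s hs) (hne t ht) (Nat.cast_le.1 hst))
  set F : ℤ → ℤ → ℝ := fun s t => (2 : ℝ) ^ s * 2 ^ t / n * E s t with hF
  have hF0 : ∀ s t, 0 ≤ F s t := fun s t => mul_nonneg (by positivity)
    (Finset.sum_nonneg fun i _ => Finset.sum_nonneg fun j _ => hA i j)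
  -- Symmetry of `E` allows ordering the two classes by size at the price of a factor 2.
  have hsym : ∑ s ∈ S, ∑ t ∈ S, (if r ≤ (2 : ℝ) ^ s * 2 ^ t then F s t else 0) ≤
      2 * ∑ s ∈ S, ∑ t ∈ S, (if N s ≤ N t ∧ r ≤ (2 : ℝ) ^ s * 2 ^ t then F s t else 0) := by
    have h1 : ∀ s t, (if r ≤ (2 : ℝ) ^ s * 2 ^ t then F s t else 0) ≤
        (if N s ≤ N t ∧ r ≤ (2 : ℝ) ^ s * 2 ^ t then F s t else 0) +
        (if N t ≤ N s ∧ r ≤ (2 : ℝ) ^ t * 2 ^ s then F t s else 0) := by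
      intro s t
      have h2 : F t s = F s t := by simp only [hF]; rw [hEsymm t s]; ring
      rw [mul_comm ((2 : ℝ) ^ t), h2]
      exact ite_le_ite_and_add_ite_and _ _ (hF0 s t) _
    calc _ ≤ ∑ s ∈ S, ∑ t ∈ S,
          ((if N s ≤ N t ∧ r ≤ (2 : ℝ) ^ s * 2 ^ t then F s t else 0) +
          (if N t ≤ N s ∧ r ≤ (2 : ℝ) ^ t * 2 ^ s then F t s else 0)) :=
        Finset.sum_le_sum fun s _ => Finset.sum_le_sum fun t _ => h1 s t
      _ = _ := by
        simp only [Finset.sum_add_distrib]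
        rw [Finset.sum_comm (f := fun s t =>
          if N t ≤ N s ∧ r ≤ (2 : ℝ) ^ t * 2 ^ s then F t s else 0)]
        ring
  -- Rounding both coordinates costs 4; with the 2 from symmetry this is the constant 8.
  have hpair : ∑ i, ∑ j, (if IsHeavyPair r x i j then |x i| * |x j| * A i j else 0) ≤
      4 * ∑ s ∈ S, ∑ t ∈ S, (if r ≤ (2 : ℝ) ^ s * 2 ^ t then F s t else 0) := by
    have h1 : ∑ i, ∑ j, (if IsHeavyPair r x i j then |x i| * |x j| * A i j else 0) =
        ∑ i ∈ V, ∑ j ∈ V, (if IsHeavyPair r x i j then |x i| * |x j| * A i j else 0) := by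
      rw [hV, Finset.sum_filter_of_ne]
      · refine Finset.sum_congr rfl fun i _ => ?_
        rw [Finset.sum_filter_of_ne]
        intro j _ h
        by_contra hj
        exact h (if_neg fun hh => hh.2.1 hj)
      · intro i _ h
        by_contra hi
        exact h (Finset.sum_eq_zero fun j _ => if_neg fun hh => hh.1 hi)
    have h2 : ∀ i ∈ V, ∀ j ∈ V, (if IsHeavyPair r x i j then |x i| * |x j| * A i j else 0) ≤
        4 * (if r ≤ (2 : ℝ) ^ dyadicLevel x i * 2 ^ dyadicLevel x j then
          (2 : ℝ) ^ dyadicLevel x i * 2 ^ dyadicLevel x j / n * A i j else 0) := by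
      intro i hi j hj
      have hAij := hA i j
      by_cases h : IsHeavyPair r x i j
      · rw [if_pos h, if_pos h.2.2]
        have h3 : |x i| * |x j| ≤ 4 * ((2 : ℝ) ^ dyadicLevel x i * 2 ^ dyadicLevel x j / n) := by
          rw [← mul_div_assoc, le_div_iff₀ hn']
          calc |x i| * |x j| * n = (Real.sqrt n * |x i|) * (Real.sqrt n * |x j|) := by
                rw [← Real.mul_self_sqrt hn'.le]
                simp only [Real.sqrt_mul_self (Real.sqrt_nonneg _)]; ring
            _ ≤ (2 * (2 : ℝ) ^ dyadicLevel x i) * (2 * 2 ^ dyadicLevel x j) :=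
              mul_le_mul (lt_two_mul_two_zpow_dyadicLevel x i).le
                (lt_two_mul_two_zpow_dyadicLevel x j).le (by positivity) (by positivity)
            _ = _ := by ring
        calc _ ≤ 4 * ((2 : ℝ) ^ dyadicLevel x i * 2 ^ dyadicLevel x j / n) * A i j := by gcongr
          _ = _ := by ring
      · rw [if_neg h]; positivity
    rw [h1]
    refine (Finset.sum_le_sum fun i hi => Finset.sum_le_sum fun j hj => h2 i hi j hj).trans_eq ?_
    simp only [← Finset.mul_sum]
    congr 1
    rw [← Finset.sum_fiberwise_of_maps_to hmaps]
    refine Finset.sum_congr rfl fun s _ => ?_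
    have h4 : ∀ i ∈ V.filter (fun i => dyadicLevel x i = s),
        ∑ j ∈ V, (if r ≤ (2 : ℝ) ^ dyadicLevel x i * 2 ^ dyadicLevel x j then
          (2 : ℝ) ^ dyadicLevel x i * 2 ^ dyadicLevel x j / n * A i j else 0) =
        ∑ t ∈ S, ∑ j ∈ I t, (if r ≤ (2 : ℝ) ^ s * 2 ^ t then
          (2 : ℝ) ^ s * 2 ^ t / n * A i j else 0) := by
      intro i hi
      rw [(Finset.mem_filter.1 hi).2, ← Finset.sum_fiberwise_of_maps_to hmaps]
      refine Finset.sum_congr rfl fun t _ => Finset.sum_congr rfl fun j hj => ?_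
      rw [(Finset.mem_filter.1 hj).2]
    rw [Finset.sum_congr rfl h4, Finset.sum_comm]
    refine Finset.sum_congr rfl fun t _ => ?_
    split_ifs
    · simp only [hF, hE, Finset.mul_sum]
      rfl
    · simp
  linarith

end HeavyMatrix

/-! ### Matrices generated by hyperedge weights -/

section PairWeight

variable {n M : ℕ}

/-- The potential hyperedges of orders `2, …, M`. -/
abbrev PotentialEdge (n M : ℕ) := {e : Finset (Fin n) // e.card ∈ Finset.Icc 2 M}

/-- The sum of `φ` over the ordered pairs of distinct vertices of `e`. -/
noncomputable def pairWeight (φ : Fin n → Fin n → ℝ) (e : Finset (Fin n)) : ℝ :=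
  ∑ p ∈ e.offDiag, φ p.1 p.2

/-- The matrix with zero diagonal whose `(i, j)` entry is the sum of `g` over the potential
hyperedges containing `i` and `j`. -/
noncomputable def edgeMatrix (g : PotentialEdge n M → ℝ) (i j : Fin n) : ℝ :=
  if i = j then 0 else ∑ e : PotentialEdge n M, if i ∈ e.1 ∧ j ∈ e.1 then g e else 0

/-- Double counting of pairs inside hyperedges. It turns row sums, edge counts and light forms alike
into linear combinations of independent indicators. -/
lemma sum_mul_edgeMatrix (φ : Fin n → Fin n → ℝ) (g : PotentialEdge n M → ℝ) :
    ∑ i, ∑ j, φ i j * edgeMatrix g i j = ∑ e, g e * pairWeight φ e.1 := by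
  have h : ∀ e : PotentialEdge n M, g e * pairWeight φ e.1 =
      ∑ i, ∑ j, if i ≠ j ∧ i ∈ e.1 ∧ j ∈ e.1 then φ i j * g e else 0 := by
    intro e
    rw [← Finset.sum_product', pairWeight, Finset.mul_sum, ← Finset.sum_filter]
    refine Finset.sum_congr ?_ fun p _ => mul_comm _ _
    ext p
    simp only [Finset.mem_offDiag, Finset.mem_filter, Finset.mem_product, Finset.mem_univ]
    tauto
  symm
  simp only [h]
  rw [Finset.sum_comm]
  refine Finset.sum_congr rfl fun i _ => ?_
  rw [Finset.sum_comm]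
  refine Finset.sum_congr rfl fun j _ => ?_
  by_cases hij : i = j
  · simp [edgeMatrix, hij]
  · simp only [edgeMatrix, hij, if_false, Finset.mul_sum, ne_eq, not_false_eq_true, true_and]
    exact Finset.sum_congr rfl fun e _ => by split_ifs <;> simp

lemma edgeMatrix_symm (g : PotentialEdge n M → ℝ) (i j : Fin n) :
    edgeMatrix g i j = edgeMatrix g j i := by
  simp only [edgeMatrix, eq_comm (a := i), and_comm (a := i ∈ _)]

lemma edgeMatrix_nonneg {g : PotentialEdge n M → ℝ} (hg : ∀ e, 0 ≤ g e) (i j : Fin n) :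
    0 ≤ edgeMatrix g i j := by
  rw [edgeMatrix]
  split_ifs
  · exact le_rfl
  · exact Finset.sum_nonneg fun e _ => by have := hg e; positivity

lemma edgeMatrix_sub (g h : PotentialEdge n M → ℝ) (i j : Fin n) :
    edgeMatrix (fun e => g e - h e) i j = edgeMatrix g i j - edgeMatrix h i j := by
  simp only [edgeMatrix]
  split_ifs
  · simp
  · rw [← Finset.sum_sub_distrib]
    exact Finset.sum_congr rfl fun e _ => by split_ifs <;> simp

lemma card_offDiag_le (e : PotentialEdge n M) :
    (e.1.offDiag.card : ℝ) ≤ (M : ℝ) * ((M : ℝ) - 1) := by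
  obtain ⟨h2, hM⟩ := Finset.mem_Icc.1 e.2
  have h2' : (2 : ℝ) ≤ (e.1.card : ℝ) := by exact_mod_cast h2
  have hM' : (e.1.card : ℝ) ≤ M := by exact_mod_cast hM
  rw [Finset.offDiag_card, Nat.cast_sub (Nat.le_mul_self _), Nat.cast_mul]
  nlinarith

lemma abs_pairWeight_le {φ : Fin n → Fin n → ℝ} {b : ℝ} (hb : 0 ≤ b) (hφ : ∀ i j, |φ i j| ≤ b)
    (e : PotentialEdge n M) : |pairWeight φ e.1| ≤ (M : ℝ) * ((M : ℝ) - 1) * b := by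
  calc _ ≤ ∑ p ∈ e.1.offDiag, |φ p.1 p.2| := Finset.abs_sum_le_sum_abs _ _
    _ ≤ ∑ p ∈ e.1.offDiag, b := Finset.sum_le_sum fun p _ => hφ _ _
    _ = e.1.offDiag.card * b := by rw [Finset.sum_const, nsmul_eq_mul]
    _ ≤ _ := mul_le_mul_of_nonneg_right (card_offDiag_le e) hb

lemma pairWeight_nonneg {φ : Fin n → Fin n → ℝ} (hφ : ∀ i j, 0 ≤ φ i j) (e : Finset (Fin n)) :
    0 ≤ pairWeight φ e :=
  Finset.sum_nonneg fun _ _ => hφ _ _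

/-- Cauchy–Schwarz over the at most `M(M - 1)` ordered pairs, used to bound variances through
entrywise means. -/
lemma sq_pairWeight_le (φ : Fin n → Fin n → ℝ) (e : PotentialEdge n M) :
    pairWeight φ e.1 ^ 2 ≤
      (M : ℝ) * ((M : ℝ) - 1) * pairWeight (fun i j => φ i j ^ 2) e.1 :=
  sq_sum_le_card_mul_sum_sq.trans
    (mul_le_mul_of_nonneg_right (card_offDiag_le e) (pairWeight_nonneg (fun _ _ => sq_nonneg _) _))

/-- A hyperedge adds to the row of a vertex one unit per other member. This `M - 1`, not `M(M - 1)`,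
is the one in the degree constant. -/
lemma pairWeight_row_le (i₀ : Fin n) (e : PotentialEdge n M) :
    pairWeight (fun i _ => if i = i₀ then 1 else 0) e.1 ≤ (M : ℝ) - 1 := by
  obtain ⟨h2, hM⟩ := Finset.mem_Icc.1 e.2
  have hM' : (e.1.card : ℝ) ≤ M := by exact_mod_cast hM
  rw [pairWeight, Finset.sum_boole]
  have hcard : (e.1.offDiag.filter fun p => p.1 = i₀).card ≤ e.1.card - 1 := by
    by_cases hi : i₀ ∈ e.1
    · rw [← Finset.card_erase_of_mem hi]
      refine Finset.card_le_card_of_injOn Prod.snd (fun p hp => ?_) (fun p hp q hq h => ?_)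
      · obtain ⟨hp1, hp2⟩ := Finset.mem_filter.1 hp
        obtain ⟨-, h2, h3⟩ := Finset.mem_offDiag.1 hp1
        rw [hp2] at h3
        exact Finset.mem_erase.2 ⟨h3.symm, h2⟩
      · exact Prod.ext ((Finset.mem_filter.1 hp).2.trans (Finset.mem_filter.1 hq).2.symm) h
    · rw [Finset.filter_false_of_mem]
      · simp
      · intro p hp hpi
        rw [← hpi] at hi
        exact hi (Finset.mem_offDiag.1 hp).1
  have : ((e.1.offDiag.filter fun p => p.1 = i₀).card : ℝ) ≤ ((e.1.card - 1 : ℕ) : ℝ) := by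
    exact_mod_cast hcard
  rw [Nat.cast_sub (by omega), Nat.cast_one] at this
  linarith

lemma sum_potentialEdge {β : Type*} [AddCommMonoid β] (f : Finset (Fin n) → β)
    (p : Finset (Fin n) → Prop) [DecidablePred p] :
    ∑ e : PotentialEdge n M, (if p e.1 then f e.1 else 0) =
      ∑ m ∈ Finset.Icc 2 M, ∑ e ∈ (Finset.powersetCard m Finset.univ).filter p, f e := by
  have h1 : ∑ e : PotentialEdge n M, (if p e.1 then f e.1 else 0) =
      ∑ e ∈ Finset.univ.filter (fun e : Finset (Fin n) => e.card ∈ Finset.Icc 2 M),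
        if p e then f e else 0 :=
    (Finset.sum_subtype _ (by simp) fun e => if p e then f e else 0).symm
  rw [h1, ← Finset.sum_fiberwise_of_maps_to (t := Finset.Icc 2 M) (g := Finset.card)
    (fun e he => (Finset.mem_filter.1 he).2)]
  refine Finset.sum_congr rfl fun m hm => ?_
  rw [Finset.sum_filter p]
  refine Finset.sum_congr ?_ fun _ _ => rfl
  ext e
  simp only [Finset.mem_filter, Finset.mem_univ, true_and, Finset.mem_powersetCard,
    Finset.subset_univ]
  constructor
  · exact fun h => h.2
  · rintro rfl
    exact ⟨hm, rfl⟩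

lemma card_powersetCard_filter_pair_le {i j : Fin n} (hij : i ≠ j) {m : ℕ} :
    ((Finset.powersetCard m Finset.univ).filter fun e => i ∈ e ∧ j ∈ e).card ≤
      (n - 2).choose (m - 2) := by
  have hc : ({i, j} : Finset (Fin n)).card = 2 := Finset.card_pair hij
  have h2 : (Finset.powersetCard (m - 2) (Finset.univ \ {i, j} : Finset (Fin n))).card =
      (n - 2).choose (m - 2) := by
    rw [Finset.card_powersetCard, Finset.card_sdiff_of_subset (Finset.subset_univ _), hc,
      Finset.card_univ, Fintype.card_fin]
  rw [← h2]
  refine Finset.card_le_card_of_injOn (fun e => e \ {i, j}) (fun e he => ?_)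
    (fun e he f hf h => ?_)
  · obtain ⟨he1, he2, he3⟩ := Finset.mem_filter.1 he
    have hsub : {i, j} ⊆ e := by
      intro k hk; rcases Finset.mem_insert.1 hk with rfl | hk
      · exact he2
      · rw [Finset.mem_singleton.1 hk]; exact he3
    refine Finset.mem_powersetCard.2 ⟨Finset.sdiff_subset_sdiff (Finset.subset_univ _) le_rfl, ?_⟩
    rw [Finset.card_sdiff_of_subset hsub, hc, (Finset.mem_powersetCard.1 he1).2]
  · obtain ⟨-, he2, he3⟩ := Finset.mem_filter.1 he
    obtain ⟨-, hf2, hf3⟩ := Finset.mem_filter.1 hf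
    ext k
    have := Finset.ext_iff.1 h k
    simp only [Finset.mem_sdiff, Finset.mem_insert, Finset.mem_singleton, not_or] at this
    by_cases hki : k = i
    · simp [hki, he2, hf2]
    · by_cases hkj : k = j
      · simp [hkj, he3, hf3]
      · tauto

/-- From `n C(n-1, m-2) = (m-1) C(n, m-1)`; this is the source of the weights `m - 1` in `d`. -/
lemma mul_choose_sub_two_le {m : ℕ} (hm : 2 ≤ m) :
    n * (n - 2).choose (m - 2) ≤ (m - 1) * n.choose (m - 1) := by
  rcases Nat.eq_zero_or_pos n with rfl | hn
  · simp
  obtain ⟨k, rfl⟩ := Nat.exists_eq_add_of_le' hn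
  obtain ⟨l, rfl⟩ := Nat.exists_eq_add_of_le' hm
  have h1 := Nat.add_one_mul_choose_eq k l
  have h2 : (k + 1 - 2).choose l ≤ k.choose l := Nat.choose_le_choose l (by omega)
  calc _ ≤ (k + 1) * k.choose l := Nat.mul_le_mul_left _ h2
    _ = _ := by rw [show l + 2 - 1 = l + 1 from rfl, mul_comm (l + 1)]; exact h1

end PairWeight

/-! ### Edge events, expectation and mean bounds -/

section RandomHypergraph

variable {Ω : Type*} {n M : ℕ}

/-- The event that the potential hyperedge `e` is present. -/
def edgeEvent (M : ℕ) (H : (m : ℕ) → Ω → UniformHypergraph n m) (e : PotentialEdge n M) : Set Ω :=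
  {ω | e.1 ∈ (H e.1.card ω).edges}

lemma adjacencyMatrix_eq_edgeMatrix (H : (m : ℕ) → Ω → UniformHypergraph n m) (ω : Ω)
    (i j : Fin n) :
    adjacencyMatrix M (fun m => H m ω) i j =
      edgeMatrix (fun e => (edgeEvent M H e).indicator (1 : Ω → ℝ) ω) i j := by
  simp only [adjacencyMatrix, Matrix.of_apply, edgeMatrix]
  split_ifs with hij
  · rfl
  have h := sum_potentialEdge (M := M) (fun e => (H e.card ω).tensor e)
    (fun e : Finset (Fin n) => i ∈ e ∧ j ∈ e)
  have h2 : ∀ e : PotentialEdge n M, (H e.1.card ω).tensor e.1 =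
      (edgeEvent M H e).indicator (1 : Ω → ℝ) ω := by
    intro e
    by_cases he : e.1 ∈ (H e.1.card ω).edges
    · rw [UniformHypergraph.tensor, Set.indicator_of_mem he,
        Set.indicator_of_mem (show ω ∈ edgeEvent M H e from he)]
      rfl
    · rw [UniformHypergraph.tensor, Set.indicator_of_notMem he,
        Set.indicator_of_notMem (show ω ∉ edgeEvent M H e from he)]
  simp only [h2] at h
  rw [h]
  refine Finset.sum_congr rfl fun m _ => ?_
  have hf : (Finset.powersetCard m Finset.univ).filter (fun e : Finset (Fin n) => {i, j} ⊆ e) =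
      (Finset.powersetCard m Finset.univ).filter (fun e => i ∈ e ∧ j ∈ e) := by
    refine Finset.filter_congr fun e _ => ?_
    simp [Finset.insert_subset_iff]
  rw [hf]
  refine Finset.sum_congr rfl fun e he => ?_
  have := (Finset.mem_powersetCard.1 (Finset.mem_filter.1 he).1).2
  subst this
  rfl

namespace IsInhomogeneousErdosRenyi

variable [MeasurableSpace Ω] {P : Measure Ω} {H : (m : ℕ) → Ω → UniformHypergraph n m}
  {d : Finset (Fin n) → ℝ}

lemma measurableSet_edgeEvent (hH : IsInhomogeneousErdosRenyi P M H d)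
    (e : PotentialEdge n M) : MeasurableSet (edgeEvent M H e) :=
  hH.measurableSet_edge _ e.2 _ rfl

lemma real_edgeEvent (hH : IsInhomogeneousErdosRenyi P M H d)
    (e : PotentialEdge n M) :
    P.real (edgeEvent M H e) = d e.1 / (n.choose (e.1.card - 1) : ℝ) :=
  hH.prob_edge _ e.2 _ rfl

lemma expectedMatrix_eq [IsProbabilityMeasure P]
    (hH : IsInhomogeneousErdosRenyi P M H d) (i j : Fin n) :
    expectedMatrix P (fun ω => adjacencyMatrix M (fun m => H m ω)) i j =
      edgeMatrix (fun e => P.real (edgeEvent M H e)) i j := by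
  simp only [expectedMatrix, Matrix.of_apply, adjacencyMatrix_eq_edgeMatrix, edgeMatrix]
  split_ifs
  · simp
  · rw [integral_finsetSum]
    · refine Finset.sum_congr rfl fun e _ => ?_
      split_ifs
      · rw [integral_indicator_one (hH.measurableSet_edgeEvent e)]
      · simp
    · intro e _
      split_ifs
      · exact (integrable_const (1 : ℝ)).indicator (hH.measurableSet_edgeEvent e)
      · exact integrable_zero _ _ _

lemma density_nonneg (hH : IsInhomogeneousErdosRenyi P M H d)
    {m : ℕ} (hm : m ∈ Finset.Icc 2 M) {e : Finset (Fin n)} (he : e.card = m) :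
    0 ≤ d e := by
  have hle : m ≤ n := by rw [← he]; simpa using e.card_le_univ
  have hc : (0 : ℝ) < n.choose (m - 1) := by
    exact_mod_cast Nat.choose_pos (by omega)
  have := hH.prob_edge m hm e he
  have h0 : 0 ≤ d e / (n.choose (m - 1) : ℝ) := by rw [← this]; exact measureReal_nonneg
  by_contra! hlt
  exact absurd h0 (not_le.2 (div_neg_of_neg_of_pos hlt hc))

lemma maxDensity_nonneg (hH : IsInhomogeneousErdosRenyi P M H d)
    {m : ℕ} (hm : m ∈ Finset.Icc 2 M) : 0 ≤ maxDensity d m :=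
  Real.iSup_nonneg fun e => hH.density_nonneg hm e.2

lemma le_maxDensity {m : ℕ} {e : Finset (Fin n)} (he : e.card = m) : d e ≤ maxDensity d m :=
  le_ciSup (f := fun e : {e : Finset (Fin n) // e.card = m} => d e.1)
    (Set.finite_range _).bddAbove ⟨e, he⟩

lemma totalDensity_nonneg (hH : IsInhomogeneousErdosRenyi P M H d) : 0 ≤ totalDensity M d :=
  Finset.sum_nonneg fun m hm => mul_nonneg (by
    have : (2 : ℝ) ≤ m := by exact_mod_cast (Finset.mem_Icc.1 hm).1
    linarith) (hH.maxDensity_nonneg hm)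

/-- The expected number of hyperedges through two given vertices is at most `d / n`. -/
lemma edgeMatrix_prob_le (hH : IsInhomogeneousErdosRenyi P M H d)
    (i j : Fin n) :
    edgeMatrix (fun e => P.real (edgeEvent M H e)) i j ≤ totalDensity M d / n := by
  have hn : (0 : ℝ) < n := by exact_mod_cast i.pos
  rw [edgeMatrix]
  split_ifs with hij
  · exact div_nonneg hH.totalDensity_nonneg hn.le
  simp only [hH.real_edgeEvent]
  rw [sum_potentialEdge (fun e => d e / (n.choose (e.card - 1) : ℝ)) (fun e => i ∈ e ∧ j ∈ e),
    totalDensity,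
    Finset.sum_div]
  refine Finset.sum_le_sum fun m hm => ?_
  have hm2 := (Finset.mem_Icc.1 hm).1
  have hd0 := hH.maxDensity_nonneg hm
  have hm1 : (0 : ℝ) ≤ (m : ℝ) - 1 := by
    have : (2 : ℝ) ≤ m := by exact_mod_cast hm2
    linarith
  calc _ ≤ ∑ e ∈ (Finset.powersetCard m Finset.univ).filter (fun e => i ∈ e ∧ j ∈ e),
        maxDensity d m / (n.choose (m - 1) : ℝ) := by
        refine Finset.sum_le_sum fun e he => ?_
        have he' := (Finset.mem_powersetCard.1 (Finset.mem_filter.1 he).1).2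
        rw [he']
        gcongr
        exact le_maxDensity he'
    _ = ((Finset.powersetCard m Finset.univ).filter
          (fun e : Finset (Fin n) => i ∈ e ∧ j ∈ e)).card *
          (maxDensity d m / (n.choose (m - 1) : ℝ)) := by
        rw [Finset.sum_const, nsmul_eq_mul]
    _ ≤ ((n - 2).choose (m - 2) : ℕ) * (maxDensity d m / (n.choose (m - 1) : ℝ)) := by
        gcongr
        exact card_powersetCard_filter_pair_le hij
    _ ≤ _ := by
        rcases Nat.eq_zero_or_pos (n.choose (m - 1)) with hc | hc
        · rw [hc]; simp only [Nat.cast_zero, div_zero, mul_zero]; positivity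
        · have hc' : (0 : ℝ) < n.choose (m - 1) := by exact_mod_cast hc
          have h := mul_choose_sub_two_le (n := n) hm2
          have h' : (n : ℝ) * ((n - 2).choose (m - 2) : ℕ) ≤
              ((m : ℝ) - 1) * (n.choose (m - 1) : ℕ) := by
            have : ((m - 1 : ℕ) : ℝ) = (m : ℝ) - 1 := by
              rw [Nat.cast_sub (by omega), Nat.cast_one]
            rw [← this]
            exact_mod_cast h
          rw [← mul_div_assoc, div_le_div_iff₀ hc' hn]
          nlinarith

lemma sum_prob_mul_pairWeight_le (hH : IsInhomogeneousErdosRenyi P M H d)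
    {φ : Fin n → Fin n → ℝ} (hφ : ∀ i j, 0 ≤ φ i j) :
    ∑ e : PotentialEdge n M, P.real (edgeEvent M H e) * pairWeight φ e.1 ≤
      totalDensity M d / n * ∑ i, ∑ j, φ i j := by
  rw [← sum_mul_edgeMatrix, Finset.mul_sum]
  refine Finset.sum_le_sum fun i _ => ?_
  rw [Finset.mul_sum]
  refine Finset.sum_le_sum fun j _ => ?_
  rw [mul_comm]
  exact mul_le_mul_of_nonneg_right (hH.edgeMatrix_prob_le i j) (hφ i j)

end IsInhomogeneousErdosRenyi

end RandomHypergraph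

/-! ### Entropy bounds for counting vertex sets -/

section Entropy

/-- The derivative of `x log (en / x)` is `log (n / x) ≥ 0`; the proof replaces calculus by `log (b
/ a) ≤ b / a - 1`. -/
lemma mul_log_exp_mul_div_mono {n a b : ℝ} (ha : 0 < a) (hab : a ≤ b) (hbn : b ≤ n) :
    a * Real.log (Real.exp 1 * n / a) ≤ b * Real.log (Real.exp 1 * n / b) := by
  have hb : 0 < b := ha.trans_le hab
  have hn : 0 < n := hb.trans_le hbn
  have he := Real.exp_pos 1
  have hlog : ∀ x : ℝ, 0 < x → Real.log (Real.exp 1 * n / x) = 1 + Real.log n - Real.log x := by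
    intro x hx
    rw [Real.log_div (by positivity) hx.ne', Real.log_mul he.ne' hn.ne', Real.log_exp]
  rw [hlog a ha, hlog b hb]
  have h1 : Real.log b ≤ Real.log n := Real.log_le_log hb hbn
  have h2 : a * (Real.log b - Real.log a) ≤ b - a := by
    rw [← Real.log_div hb.ne' ha.ne']
    have := Real.log_le_sub_one_of_pos (div_pos hb ha)
    calc _ ≤ a * (b / a - 1) := mul_le_mul_of_nonneg_left this ha.le
      _ = _ := by field_simp
  nlinarith [mul_nonneg (sub_nonneg.2 hab) (sub_nonneg.2 h1)]

/-- A single term of the expansion of `(1 + b / n) ^ n ≤ e ^ b`. -/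
lemma choose_le_exp {n b : ℕ} (hb : 0 < b) (hbn : b ≤ n) :
    (n.choose b : ℝ) ≤ Real.exp (b * Real.log (Real.exp 1 * n / b)) := by
  have hb' : (0 : ℝ) < b := by exact_mod_cast hb
  have hn' : (0 : ℝ) < n := by exact_mod_cast hb.trans_le hbn
  have h1 : ((b : ℝ) / n) ^ b * n.choose b ≤ Real.exp 1 ^ b := by
    calc ((b : ℝ) / n) ^ b * n.choose b ≤ ∑ k ∈ Finset.range (n + 1),
          ((b : ℝ) / n) ^ k * 1 ^ (n - k) * n.choose k := by
          refine le_trans (le_of_eq ?_) (Finset.single_le_sum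
            (f := fun k => ((b : ℝ) / n) ^ k * 1 ^ (n - k) * n.choose k)
            (fun k _ => by positivity) (Finset.mem_range.2 (Nat.lt_succ_of_le hbn)))
          simp
      _ = ((b : ℝ) / n + 1) ^ n := (add_pow _ _ _).symm
      _ ≤ Real.exp ((b : ℝ) / n) ^ n := by
          gcongr
          exact Real.add_one_le_exp _
      _ = Real.exp 1 ^ b := by
          rw [← Real.exp_nat_mul, ← Real.exp_nat_mul]
          congr 1
          field_simp
  rw [Real.exp_nat_mul, Real.exp_log (by positivity)]
  calc (n.choose b : ℝ) = ((n : ℝ) / b) ^ b * (((b : ℝ) / n) ^ b * n.choose b) := by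
        rw [← mul_assoc, ← mul_pow]
        field_simp
        simp
    _ ≤ ((n : ℝ) / b) ^ b * Real.exp 1 ^ b := by gcongr
    _ = _ := by rw [← mul_pow]; congr 1; ring

/-- With `f b = b log (en / b)`, the `C(n, b) ≤ e^{f b}` sets of size `b` use up one unit of `f b`.
The rest, `(K + 2) / 2` units with `f b ≥ log n`, leaves a spare factor `1 / n` for the sum over
`b`. -/
lemma sum_nonempty_exp_neg_le {n : ℕ} (hn : 1 ≤ n) {K : ℝ} (hK : 0 < K) :
    ∑ I : Finset (Fin n) with I.Nonempty,
      Real.exp (-((K + 4) / 2 * (I.card * Real.log (Real.exp 1 * n / I.card)))) ≤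
        (n : ℝ) ^ (-(K / 2)) := by
  have hn' : (0 : ℝ) < n := by exact_mod_cast hn
  set f : ℕ → ℝ := fun b => b * Real.log (Real.exp 1 * n / b) with hf
  have hmaps : ∀ I ∈ (Finset.univ.filter fun I : Finset (Fin n) => I.Nonempty),
      I.card ∈ Finset.Icc 1 n := fun I hI =>
    Finset.mem_Icc.2 ⟨(Finset.mem_filter.1 hI).2.card_pos, by simpa using I.card_le_univ⟩
  rw [← Finset.sum_fiberwise_of_maps_to hmaps]
  have hb : ∀ b ∈ Finset.Icc 1 n,
      ∑ I ∈ (Finset.univ.filter fun I : Finset (Fin n) => I.Nonempty) with I.card = b,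
        Real.exp (-((K + 4) / 2 * f I.card)) ≤ (n : ℝ) ^ (-((K + 2) / 2)) := by
    intro b hb
    obtain ⟨hb1, hbn⟩ := Finset.mem_Icc.1 hb
    have hcard : ((Finset.univ.filter fun I : Finset (Fin n) => I.Nonempty).filter
        fun I => I.card = b).card ≤ n.choose b := by
      calc _ ≤ (Finset.powersetCard b (Finset.univ : Finset (Fin n))).card :=
            Finset.card_le_card fun I hI => Finset.mem_powersetCard.2
              ⟨Finset.subset_univ _, (Finset.mem_filter.1 hI).2⟩
        _ = _ := by rw [Finset.card_powersetCard, Finset.card_univ, Fintype.card_fin]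
    have hf1 : Real.log n ≤ f b := by
      have := mul_log_exp_mul_div_mono (n := n) one_pos (by exact_mod_cast hb1 : (1 : ℝ) ≤ b)
        (by exact_mod_cast hbn)
      rw [one_mul, div_one, Real.log_mul (Real.exp_pos 1).ne' hn'.ne', Real.log_exp] at this
      simp only [hf]
      linarith
    rw [Finset.sum_congr rfl (g := fun _ => Real.exp (-((K + 4) / 2 * f b)))
      (fun I hI => by rw [(Finset.mem_filter.1 hI).2]), Finset.sum_const, nsmul_eq_mul]
    calc _ ≤ Real.exp (f b) * Real.exp (-((K + 4) / 2 * f b)) := by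
          gcongr
          exact le_trans (by exact_mod_cast hcard) (choose_le_exp hb1 hbn)
      _ = Real.exp (-((K + 2) / 2 * f b)) := by rw [← Real.exp_add]; congr 1; ring
      _ ≤ Real.exp (Real.log n * (-((K + 2) / 2))) := by
          apply Real.exp_le_exp.2
          nlinarith
      _ = _ := by rw [Real.rpow_def_of_pos hn']
  refine (Finset.sum_le_sum hb).trans_eq ?_
  rw [Finset.sum_const, Nat.card_Icc, nsmul_eq_mul, Nat.add_sub_cancel]
  nth_rewrite 1 [← Real.rpow_one (n : ℝ)]
  rw [← Real.rpow_add hn']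
  congr 1
  ring

end Entropy

/-! ### The three high-probability events -/

section RandomHypergraph

variable {Ω : Type*} {n M : ℕ}

lemma pairing_edgeMatrix_indicator (H : (m : ℕ) → Ω → UniformHypergraph n m)
    (φ : Fin n → Fin n → ℝ) (ω : Ω) :
    ∑ i, ∑ j, φ i j * edgeMatrix (fun e => (edgeEvent M H e).indicator (1 : Ω → ℝ) ω) i j =
      ∑ e : PotentialEdge n M, pairWeight φ e.1 * (edgeEvent M H e).indicator (1 : Ω → ℝ) ω := by
  rw [sum_mul_edgeMatrix]
  exact Finset.sum_congr rfl fun e _ => mul_comm _ _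

/-- The edge count between `I` and `J` violates the discrepancy property. -/
def IsDiscrepant (A : Fin n → Fin n → ℝ) (δ C₂ : ℝ) (I J : Finset (Fin n)) : Prop :=
  Real.exp 2 * (δ / n * I.card * J.card) < ∑ i ∈ I, ∑ j ∈ J, A i j ∧
    C₂ * (J.card * Real.log (Real.exp 1 * n / J.card)) <
      (∑ i ∈ I, ∑ j ∈ J, A i j) *
        Real.log ((∑ i ∈ I, ∑ j ∈ J, A i j) / (δ / n * I.card * J.card))

open Classical in
/-- The light part of the rank-one matrix `x xᵀ`. -/
noncomputable def lightPart (r : ℝ) (x : Fin n → ℝ) (i j : Fin n) : ℝ :=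
  if IsHeavyPair r x i j then 0 else x i * x j

namespace IsInhomogeneousErdosRenyi

variable [MeasurableSpace Ω] {P : Measure Ω} [IsProbabilityMeasure P]
  {H : (m : ℕ) → Ω → UniformHypergraph n m} {d : Finset (Fin n) → ℝ}

/-- With high probability all the vertex degrees are bounded by a multiple of the density. -/
lemma prob_degree_gt_le (hH : IsInhomogeneousErdosRenyi P M H d) (hM : 2 ≤ M) (hn : 1 ≤ n)
    {c K : ℝ} (hc : 0 < c) (hK : 0 < K) (hd : c * Real.log n ≤ totalDensity M d) :
    P.real {ω | ∃ i, (2 + ((M : ℝ) - 1) * (1 + K) / c) * totalDensity M d <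
        ∑ j, edgeMatrix (fun e => (edgeEvent M H e).indicator (1 : Ω → ℝ) ω) i j} ≤
      (n : ℝ) ^ (-K) := by
  have hn' : (0 : ℝ) < n := by exact_mod_cast hn
  have hM' : (1 : ℝ) ≤ (M : ℝ) - 1 := by
    have : (2 : ℝ) ≤ M := by exact_mod_cast hM
    linarith
  set q := ((M : ℝ) - 1) * (1 + K) / c with hq
  have hq0 : 0 ≤ q := by positivity
  set D := 2 + q with hD
  have hd0 := hH.totalDensity_nonneg
  set δ := totalDensity M d with hδ
  -- From `log D ≥ 2 - e / D` the entropy is at least `D - e + 1`, which exceeds `D - 2 = q` because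
  -- `e < 3`.
  have hent : q ≤ D * Real.log D - D + 1 := by
    have h1 := Real.one_sub_inv_le_log_of_pos (x := D / Real.exp 1) (by positivity)
    rw [Real.log_div (by positivity) (Real.exp_pos 1).ne', Real.log_exp, inv_div] at h1
    have h2 := mul_le_mul_of_nonneg_left h1 (show 0 ≤ D by positivity)
    have hD0 : D ≠ 0 := by positivity
    have h3 : D * (1 - Real.exp 1 / D) = D - Real.exp 1 := by
      rw [mul_sub, mul_one, mul_div_cancel₀ _ hD0]
    rw [h3] at h2
    have := Real.exp_one_lt_d9
    linarith
  have hi : ∀ i : Fin n, P.real {ω | D * δ ≤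
      ∑ e : PotentialEdge n M, pairWeight (fun k _ => if k = i then 1 else 0) e.1 *
        (edgeEvent M H e).indicator (1 : Ω → ℝ) ω} ≤ (n : ℝ) ^ (-(1 + K)) := by
    intro i
    have hφ : ∀ k j : Fin n, (0 : ℝ) ≤ (fun k (_ : Fin n) => if k = i then (1 : ℝ) else 0) k j :=
      fun k j => by simp only; positivity
    have hmean := hH.sum_prob_mul_pairWeight_le hφ
    have hsum : ∑ k : Fin n, ∑ _j : Fin n, (if k = i then (1 : ℝ) else 0) = n := by
      simp
    simp only [hsum] at hmean
    rw [div_mul_cancel₀ _ hn'.ne'] at hmean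
    refine (chernoff_indicator hH.measurableSet_edgeEvent hH.indep_edges
      (w := (M : ℝ) - 1) (by linarith) (fun e => pairWeight_nonneg hφ e.1)
      (fun e => pairWeight_row_le i e) hmean (by linarith)).trans ?_
    rw [Real.rpow_def_of_pos hn']
    apply Real.exp_le_exp.2
    have h1 : δ / ((M : ℝ) - 1) * q ≤ δ / ((M : ℝ) - 1) * (D * Real.log D - D + 1) := by
      gcongr
    have h2 : δ / ((M : ℝ) - 1) * q = δ / c * (1 + K) := by
      rw [hq]; field_simp
    -- The density assumption enters here: the Chernoff exponent is at least `(1 + K) log n`, one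
    -- `log n` being spent on the union over vertices.
    have h3 : Real.log n ≤ δ / c := by rw [le_div_iff₀ hc]; linarith
    have h4 : Real.log n * (1 + K) ≤ δ / c * (1 + K) := by gcongr
    linarith
  have hsub : {ω | ∃ i, D * δ <
        ∑ j, edgeMatrix (fun e => (edgeEvent M H e).indicator (1 : Ω → ℝ) ω) i j} ⊆
      ⋃ i ∈ (Finset.univ : Finset (Fin n)), {ω | D * δ ≤
      ∑ e : PotentialEdge n M, pairWeight (fun k _ => if k = i then 1 else 0) e.1 *
        (edgeEvent M H e).indicator (1 : Ω → ℝ) ω} := by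
    rintro ω ⟨i, hω⟩
    refine Set.mem_iUnion₂.2 ⟨i, Finset.mem_univ i, ?_⟩
    rw [Set.mem_ofPred_eq, ← pairing_edgeMatrix_indicator]
    simpa using hω.le
  refine (measureReal_mono hsub (measure_ne_top _ _)).trans ((measureReal_biUnion_finset_le _ _).trans ?_)
  refine (Finset.sum_le_sum fun i _ => hi i).trans_eq ?_
  rw [Finset.sum_const, Finset.card_univ, Fintype.card_fin, nsmul_eq_mul]
  nth_rewrite 1 [← Real.rpow_one (n : ℝ)]
  rw [← Real.rpow_add hn']
  congr 1
  ring

lemma prob_isDiscrepant_le (hH : IsInhomogeneousErdosRenyi P M H d) (hM : 2 ≤ M)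
    (hd : 0 < totalDensity M d) {K : ℝ} (hK : 0 < K) {I J : Finset (Fin n)} (hI : I.Nonempty)
    (hJ : J.Nonempty) :
    P.real {ω | IsDiscrepant
        (edgeMatrix fun e => (edgeEvent M H e).indicator (1 : Ω → ℝ) ω) (totalDensity M d)
        (2 * ((M : ℝ) * ((M : ℝ) - 1)) * (K + 4)) I J} ≤
      Real.exp (-((K + 4) * (J.card * Real.log (Real.exp 1 * n / J.card)))) := by
  have hn' : (0 : ℝ) < n := by exact_mod_cast hI.choose.pos
  have hM' : (2 : ℝ) ≤ M := by exact_mod_cast hM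
  set w := (M : ℝ) * ((M : ℝ) - 1) with hw
  have hw0 : 0 < w := by rw [hw]; nlinarith
  have hI' : (0 : ℝ) < I.card := by exact_mod_cast hI.card_pos
  have hJ' : (0 : ℝ) < J.card := by exact_mod_cast hJ.card_pos
  have hJn : (J.card : ℝ) ≤ n := by
    have : J.card ≤ n := by simpa using J.card_le_univ
    exact_mod_cast this
  set φ : Fin n → Fin n → ℝ := fun i j => if i ∈ I ∧ j ∈ J then 1 else 0 with hφ
  have hφ0 : ∀ i j, 0 ≤ φ i j := fun i j => by simp only [hφ]; positivity
  have hφ1 : ∀ i j, |φ i j| ≤ 1 := fun i j => by simp only [hφ]; split_ifs <;> simp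
  have hφsum : ∀ A : Fin n → Fin n → ℝ, ∑ i, ∑ j, φ i j * A i j = ∑ i ∈ I, ∑ j ∈ J, A i j := by
    intro A
    calc ∑ i, ∑ j, φ i j * A i j =
          ∑ i, if i ∈ I then ∑ j, if j ∈ J then A i j else 0 else 0 := by
          refine Finset.sum_congr rfl fun i _ => ?_
          by_cases hi : i ∈ I <;> simp [hφ, hi]
      _ = _ := by simp
  have hmean := hH.sum_prob_mul_pairWeight_le hφ0
  have hcount : ∑ i, ∑ j, φ i j = I.card * J.card := by
    have := hφsum fun _ _ => 1
    simpa using this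
  rw [hcount, ← mul_assoc] at hmean
  have hlog : 0 ≤ Real.log (Real.exp 1 * n / J.card) := by
    apply Real.log_nonneg
    rw [le_div_iff₀ hJ', one_mul]
    have := Real.one_le_exp zero_le_one
    nlinarith
  -- Indicator weights have coefficients at most `w`, so the factor `2w` in the threshold cancels
  -- the `2w` of the tail bound.
  have h := prob_mul_log_gt_le hH.measurableSet_edgeEvent hH.indep_edges hw0
    (fun e => pairWeight_nonneg hφ0 e.1)
    (fun e => (le_abs_self _).trans ((abs_pairWeight_le zero_le_one hφ1 e).trans_eq (mul_one _)))
    hmean (by positivity)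
    (show 0 ≤ 2 * w * (K + 4) * (J.card * Real.log (Real.exp 1 * n / J.card)) by positivity)
  simp only [← pairing_edgeMatrix_indicator, hφsum] at h
  refine h.trans_eq ?_
  congr 2
  field_simp

/-- With high probability the discrepancy property holds for all pairs of vertex sets. -/
lemma prob_exists_isDiscrepant_le (hH : IsInhomogeneousErdosRenyi P M H d) (hM : 2 ≤ M)
    (hn : 1 ≤ n) (hd : 0 < totalDensity M d) {K : ℝ} (hK : 0 < K) :
    P.real {ω | ∃ I J : Finset (Fin n), I.Nonempty ∧ J.Nonempty ∧ I.card ≤ J.card ∧ IsDiscrepant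
        (edgeMatrix fun e => (edgeEvent M H e).indicator (1 : Ω → ℝ) ω) (totalDensity M d)
        (2 * ((M : ℝ) * ((M : ℝ) - 1)) * (K + 4)) I J} ≤ (n : ℝ) ^ (-K) := by
  have hn' : (0 : ℝ) < n := by exact_mod_cast hn
  set f : Finset (Fin n) → ℝ := fun I => I.card * Real.log (Real.exp 1 * n / I.card) with hf
  set U := Finset.univ.filter fun I : Finset (Fin n) => I.Nonempty with hU
  set B : Finset (Fin n) → Finset (Fin n) → Set Ω := fun I J => {ω | I.card ≤ J.card ∧ IsDiscrepant
        (edgeMatrix fun e => (edgeEvent M H e).indicator (1 : Ω → ℝ) ω) (totalDensity M d)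
        (2 * ((M : ℝ) * ((M : ℝ) - 1)) * (K + 4)) I J} with hB
  -- Since `f I ≤ f J`, the exponent `(K + 4) f J` can be shared equally between the two sets, and
  -- the double sum factorises.
  have hBle : ∀ I ∈ U, ∀ J ∈ U, P.real (B I J) ≤
      Real.exp (-((K + 4) / 2 * f I)) * Real.exp (-((K + 4) / 2 * f J)) := by
    intro I hI J hJ
    have hI := (Finset.mem_filter.1 hI).2
    have hJ := (Finset.mem_filter.1 hJ).2
    by_cases hIJ : I.card ≤ J.card
    · refine (measureReal_mono fun ω hω => hω.2).trans
        ((hH.prob_isDiscrepant_le hM hd hK hI hJ).trans ?_)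
      rw [← Real.exp_add]
      apply Real.exp_le_exp.2
      have hJn : J.card ≤ n := by simpa using J.card_le_univ
      have : f I ≤ f J := mul_log_exp_mul_div_mono (by exact_mod_cast hI.card_pos)
        (by exact_mod_cast hIJ) (by exact_mod_cast hJn)
      change -((K + 4) * f J) ≤ _
      nlinarith
    · have : B I J = ∅ := Set.eq_empty_of_forall_notMem fun ω hω => hIJ hω.1
      rw [this, measureReal_empty]
      positivity
  refine (measureReal_mono (s₂ := ⋃ I ∈ U, ⋃ J ∈ U, B I J) ?_ (measure_ne_top _ _)).trans ?_
  · rintro ω ⟨I, J, hI, hJ, h⟩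
    exact Set.mem_iUnion₂.2 ⟨I, Finset.mem_filter.2 ⟨Finset.mem_univ _, hI⟩,
      Set.mem_iUnion₂.2 ⟨J, Finset.mem_filter.2 ⟨Finset.mem_univ _, hJ⟩, h⟩⟩
  calc _ ≤ ∑ I ∈ U, P.real (⋃ J ∈ U, B I J) := measureReal_biUnion_finset_le _ _
    _ ≤ ∑ I ∈ U, ∑ J ∈ U, P.real (B I J) :=
        Finset.sum_le_sum fun I _ => measureReal_biUnion_finset_le _ _
    _ ≤ ∑ I ∈ U, ∑ J ∈ U,
        Real.exp (-((K + 4) / 2 * f I)) * Real.exp (-((K + 4) / 2 * f J)) :=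
        Finset.sum_le_sum fun I hI => Finset.sum_le_sum fun J hJ => hBle I hI J hJ
    _ = (∑ I ∈ U, Real.exp (-((K + 4) / 2 * f I))) *
        ∑ J ∈ U, Real.exp (-((K + 4) / 2 * f J)) := by rw [Finset.sum_mul_sum]
    _ ≤ (n : ℝ) ^ (-(K / 2)) * (n : ℝ) ^ (-(K / 2)) := by
        have := sum_nonempty_exp_neg_le hn hK
        exact mul_le_mul this this (Finset.sum_nonneg fun _ _ => (Real.exp_pos _).le)
          (by positivity)
    _ = _ := by rw [← Real.rpow_add hn']; congr 1; ring

/-- With high probability the light part of the quadratic form is small on a net. -/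
lemma prob_light_le (hH : IsInhomogeneousErdosRenyi P M H d) (hM : 2 ≤ M) (hn : 1 ≤ n)
    (hd : 0 < totalDensity M d) {s : Finset (EuclideanSpace ℝ (Fin n))} (hs : s.card ≤ 9 ^ n)
    (hs1 : ∀ x ∈ s, ‖x‖ ≤ 1) :
    P.real {ω | ∃ x ∈ s, 16 * ((M : ℝ) * ((M : ℝ) - 1)) * Real.sqrt (totalDensity M d) ≤
      |∑ e : PotentialEdge n M, pairWeight (lightPart (Real.sqrt (totalDensity M d)) x) e.1 *
        ((edgeEvent M H e).indicator (1 : Ω → ℝ) ω - P.real (edgeEvent M H e))|} ≤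
      2 * Real.exp (-(n : ℝ)) := by
  have hn' : (0 : ℝ) < n := by exact_mod_cast hn
  have hM' : (2 : ℝ) ≤ M := by exact_mod_cast hM
  set w := (M : ℝ) * ((M : ℝ) - 1) with hw
  have hw2 : 2 ≤ w := by rw [hw]; nlinarith
  have hw0 : 0 < w := by linarith
  set r := Real.sqrt (totalDensity M d) with hr
  have hr0 : 0 < r := Real.sqrt_pos.2 hd
  have hr2 : r ^ 2 = totalDensity M d := Real.sq_sqrt hd.le
  have hx : ∀ x ∈ s, P.real {ω | 16 * w * r ≤
      |∑ e : PotentialEdge n M, pairWeight (lightPart r x) e.1 *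
        ((edgeEvent M H e).indicator (1 : Ω → ℝ) ω - P.real (edgeEvent M H e))|} ≤
      2 * Real.exp (-(3.5 * n)) := by
    intro x hx
    have hx2 : ∑ i, x i ^ 2 ≤ 1 := by
      rw [← EuclideanSpace.real_norm_sq_eq]
      exact pow_le_one₀ (norm_nonneg _) (hs1 x hx)
    have hl : ∀ i j, |lightPart r x i j| ≤ 4 * r / n := by
      intro i j
      rw [lightPart]
      split_ifs with h
      · rw [abs_zero]; positivity
      · rw [abs_mul, le_div_iff₀ hn', mul_comm]
        exact mul_le_of_not_isHeavyPair hr0.le h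
    have hv : ∑ e : PotentialEdge n M, P.real (edgeEvent M H e) *
        pairWeight (lightPart r x) e.1 ^ 2 ≤ w * (r ^ 2 / n) := by
      calc _ ≤ ∑ e : PotentialEdge n M, w * (P.real (edgeEvent M H e) *
            pairWeight (fun i j => lightPart r x i j ^ 2) e.1) := by
            refine Finset.sum_le_sum fun e _ => ?_
            have := mul_le_mul_of_nonneg_left (sq_pairWeight_le (lightPart r x) e)
              (measureReal_nonneg (μ := P) (s := edgeEvent M H e))
            calc _ ≤ _ := this
              _ = _ := by rw [hw]; ring
        _ = w * ∑ e : PotentialEdge n M, P.real (edgeEvent M H e) *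
            pairWeight (fun i j => lightPart r x i j ^ 2) e.1 := by rw [Finset.mul_sum]
        _ ≤ w * (totalDensity M d / n * ∑ i, ∑ j, lightPart r x i j ^ 2) := by
            gcongr
            exact hH.sum_prob_mul_pairWeight_le fun i j => sq_nonneg _
        _ ≤ w * (totalDensity M d / n * 1) := by
            gcongr
            calc ∑ i, ∑ j, lightPart r x i j ^ 2 ≤ ∑ i, ∑ j, x i ^ 2 * x j ^ 2 := by
                  refine Finset.sum_le_sum fun i _ => Finset.sum_le_sum fun j _ => ?_
                  rw [lightPart]
                  split_ifs
                  · rw [zero_pow two_ne_zero]; positivity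
                  · rw [mul_pow]
              _ = (∑ i, x i ^ 2) * ∑ j, x j ^ 2 := by rw [Finset.sum_mul_sum]
              _ ≤ 1 * 1 := mul_le_mul hx2 hx2 (by positivity) zero_le_one
              _ = 1 := one_mul 1
        _ = _ := by rw [mul_one, hr2]
    refine (bernstein_indicator_abs hH.measurableSet_edgeEvent hH.indep_edges
      (b := w * (4 * r / n)) (by positivity)
      (fun e => abs_pairWeight_le (by positivity) hl e) hv (16 * w * r)).trans ?_
    gcongr
    -- Height 16 against coefficients `4wr / n` gives `4n`; the variance term costs only `n / (16w)
    -- ≤ n / 32`, leaving more than `3.5n`.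
    have e1 : 16 * w * r / (w * (4 * r / n)) = 4 * n := by field_simp; norm_num
    have e2 : w * (r ^ 2 / n) / (w * (4 * r / n)) ^ 2 = n / (16 * w) := by field_simp; norm_num
    have e3 : (n : ℝ) / (16 * w) ≤ n / 32 := by gcongr; linarith
    rw [e1, e2]
    linarith
  have hsub : {ω | ∃ x ∈ s, 16 * w * r ≤
      |∑ e : PotentialEdge n M, pairWeight (lightPart r x) e.1 *
        ((edgeEvent M H e).indicator (1 : Ω → ℝ) ω - P.real (edgeEvent M H e))|} ⊆
      ⋃ x ∈ s, {ω | 16 * w * r ≤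
      |∑ e : PotentialEdge n M, pairWeight (lightPart r x) e.1 *
        ((edgeEvent M H e).indicator (1 : Ω → ℝ) ω - P.real (edgeEvent M H e))|} := by
    rintro ω ⟨x, hx, h⟩
    exact Set.mem_iUnion₂.2 ⟨x, hx, h⟩
  refine (measureReal_mono hsub (measure_ne_top _ _)).trans ((measureReal_biUnion_finset_le _ _).trans ?_)
  refine (Finset.sum_le_sum hx).trans ?_
  rw [Finset.sum_const, nsmul_eq_mul]
  -- The net costs at most `e^{2.5n}`, so `e^{-n}` remains of `e^{-3.5n}`.
  have h9 : (9 : ℝ) ≤ Real.exp 2.5 := by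
    have h1 : Real.exp 2.5 = Real.exp 1 ^ 2 * Real.exp 0.5 := by
      rw [← Real.exp_nat_mul, ← Real.exp_add]; norm_num
    have h2 := Real.exp_one_gt_d9
    have h3 : (1.5 : ℝ) ≤ Real.exp 0.5 := by
      have := Real.add_one_le_exp (0.5 : ℝ)
      linarith
    rw [h1]
    nlinarith
  calc _ ≤ Real.exp 2.5 ^ n * (2 * Real.exp (-(3.5 * n))) := by
        gcongr
        calc (s.card : ℝ) ≤ 9 ^ n := by exact_mod_cast hs
          _ ≤ _ := by gcongr
    _ = 2 * (Real.exp (n * 2.5) * Real.exp (-(3.5 * n))) := by rw [Real.exp_nat_mul]; ring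
    _ = _ := by rw [← Real.exp_add]; congr 2; ring

end IsInhomogeneousErdosRenyi

end RandomHypergraph

/-! ### Combining the light and heavy parts -/

section Assembly

variable {n : ℕ}

/-- A deterministic bound for the quadratic form of `A - B`: the light part is bounded by
hypothesis, and the heavy pairs are controlled by the degrees and the discrepancy of `A` and by
the size of the entries of `B`. -/
lemma abs_quadratic_form_sub_le (hn : 0 < n) {A B : Fin n → Fin n → ℝ} {x : Fin n → ℝ}
    {r D C₂ L : ℝ} (hr : 0 < r) (hD : 0 ≤ D) (hC₂ : 0 ≤ C₂) (hA : ∀ i j, 0 ≤ A i j)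
    (hsymm : ∀ i j, A i j = A j i) (hB0 : ∀ i j, 0 ≤ B i j) (hB : ∀ i j, B i j ≤ r ^ 2 / n)
    (hx : ∑ i, x i ^ 2 ≤ 1) (hdeg : ∀ i, ∑ j, A i j ≤ D * r ^ 2)
    (hdisc : ∀ I J : Finset (Fin n), I.Nonempty → J.Nonempty → I.card ≤ J.card →
      ¬IsDiscrepant A (r ^ 2) C₂ I J)
    (hlight : |∑ i, ∑ j, lightPart r x i j * (A i j - B i j)| ≤ L) :
    |∑ i, ∑ j, x i * x j * (A i j - B i j)| ≤ L + 8 * (r * (13 + 4 * D + 27 * C₂)) + r := by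
  classical
  have hn' : (0 : ℝ) < n := by exact_mod_cast hn
  have hsplit : ∑ i, ∑ j, x i * x j * (A i j - B i j) =
      ∑ i, ∑ j, lightPart r x i j * (A i j - B i j) +
      ∑ i, ∑ j, (if IsHeavyPair r x i j then x i * x j * A i j else 0) -
      ∑ i, ∑ j, (if IsHeavyPair r x i j then x i * x j * B i j else 0) := by
    simp only [← Finset.sum_add_distrib, ← Finset.sum_sub_distrib]
    refine Finset.sum_congr rfl fun i _ => Finset.sum_congr rfl fun j _ => ?_
    rw [lightPart]
    split_ifs <;> ring
  have habs : ∀ F : Fin n → Fin n → ℝ, (∀ i j, 0 ≤ F i j) →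
      |∑ i, ∑ j, (if IsHeavyPair r x i j then x i * x j * F i j else 0)| ≤
      ∑ i, ∑ j, (if IsHeavyPair r x i j then |x i| * |x j| * F i j else 0) := by
    intro F hF
    refine (Finset.abs_sum_le_sum_abs _ _).trans (Finset.sum_le_sum fun i _ => ?_)
    refine (Finset.abs_sum_le_sum_abs _ _).trans (Finset.sum_le_sum fun j _ => ?_)
    split_ifs
    · rw [abs_mul, abs_mul, abs_of_nonneg (hF i j)]
    · rw [abs_zero]
  have h1 := (habs A hA).trans (heavy_sum_le hn hr hD hC₂ hA hsymm hx hdeg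
    fun I J hI hJ hIJ => by
      have := hdisc I J hI hJ hIJ
      rw [IsDiscrepant, not_and_or, not_lt, not_lt] at this
      exact this)
  have h2 : |∑ i, ∑ j, (if IsHeavyPair r x i j then x i * x j * B i j else 0)| ≤ r := by
    refine (habs B hB0).trans ?_
    calc _ ≤ ∑ i, ∑ j, r * (x i ^ 2 * x j ^ 2) := by
          refine Finset.sum_le_sum fun i _ => Finset.sum_le_sum fun j _ => ?_
          split_ifs with h
          · have h3 := h.le_mul
            have h4 : 0 ≤ |x i| * |x j| := by positivity
            -- On a heavy pair `r ≤ n |x_i x_j|`, so the entry bound `r² / n` is itself at most `r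
            -- |x_i x_j|`.
            have h5 : r ^ 2 / n ≤ r * (|x i| * |x j|) := by
              rw [div_le_iff₀ hn']
              nlinarith
            calc _ ≤ |x i| * |x j| * (r * (|x i| * |x j|)) :=
                  mul_le_mul_of_nonneg_left ((hB i j).trans h5) h4
              _ = r * (|x i| ^ 2 * |x j| ^ 2) := by ring
              _ = _ := by rw [sq_abs, sq_abs]
          · positivity
      _ = r * ((∑ i, x i ^ 2) * ∑ j, x j ^ 2) := by
          rw [Finset.sum_mul_sum]
          simp only [Finset.mul_sum]
      _ ≤ r * (1 * 1) := by
          gcongr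
      _ = r := by ring
  rw [hsplit]
  refine (abs_sub _ _).trans (add_le_add ((abs_add_le _ _).trans (add_le_add hlight h1)) h2)

lemma matrixSpectralNorm_le_of_net {W : Matrix (Fin n) (Fin n) ℝ} (hW : W.IsHermitian)
    {s : Finset (EuclideanSpace ℝ (Fin n))} (hs1 : ∀ c ∈ s, ‖c‖ ≤ 1)
    (hs : ∀ x : EuclideanSpace ℝ (Fin n), ‖x‖ ≤ 1 → ∃ c ∈ s, ‖x - c‖ ≤ 1 / 4) {B : ℝ}
    (hB : ∀ c ∈ s, |∑ i, ∑ j, c i * c j * W i j| ≤ B) : matrixSpectralNorm W ≤ 2 * B := by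
  refine norm_le_of_net ?_ hs1 hs fun c hc => ?_
  · rw [Matrix.coe_toEuclideanCLM_eq_toEuclideanLin]
    exact Matrix.isSymmetric_toEuclideanLin_iff.2 hW
  · rw [Matrix.inner_toEuclideanCLM]
    convert hB c hc using 2
    simp only [dotProduct, Matrix.mulVec, Finset.mul_sum]
    exact Finset.sum_congr rfl fun i _ => Finset.sum_congr rfl fun j _ => by ring

lemma spectral_constant_le {w D K : ℝ} (hw : 2 ≤ w) (hD : 2 ≤ D) (hK : 0 < K) :
    2 * (16 * w + 8 * (13 + 4 * D + 27 * (2 * w * (K + 4))) + 1) ≤ 512 * w * (K + 6) * D := by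
  have h1 : 0 ≤ w * K := by positivity
  have h2 : 0 ≤ w * (D - 2) := mul_nonneg (by linarith) (by linarith)
  have h3 : 0 ≤ w * K * (D - 2) := mul_nonneg h1 (by linarith)
  have h4 : 0 ≤ (w - 2) * (D - 2) := mul_nonneg (by linarith) (by linarith)
  nlinarith

end Assembly

theorem theorem3 {Ω : Type*} [MeasurableSpace Ω] (P : Measure Ω) [IsProbabilityMeasure P]
    (n M : ℕ) (hM : 2 ≤ M)
    (H : (m : ℕ) → Ω → UniformHypergraph n m) (d : Finset (Fin n) → ℝ)
    (hH : IsInhomogeneousErdosRenyi P M H d)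
    (c : ℝ) (hc : 0 < c) (hd : c * Real.log n ≤ totalDensity M d)
    (K : ℝ) (hK : 0 < K) :
    1 - 2 * (n : ℝ) ^ (-K) - 2 * Real.exp (-(n : ℝ)) ≤
      P.real {ω |
        matrixSpectralNorm
            (adjacencyMatrix M (fun m => H m ω) -
              expectedMatrix P (fun ω' => adjacencyMatrix M (fun m => H m ω'))) ≤
          (512 * (M : ℝ) * ((M : ℝ) - 1) * (K + 6) * (2 + ((M : ℝ) - 1) * (1 + K) / c)) *
            Real.sqrt (totalDensity M d)} := by
  -- For `n < 2` the claimed lower bound is not positive; at `n = 0` the convention `0 ^ (-K) = 0`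
  -- leaves `1 - 2`. For `n ≥ 2`, `log n > 0` makes the density positive.
  rcases Nat.lt_or_ge n 2 with hn | hn
  · refine le_trans ?_ measureReal_nonneg
    interval_cases n
    · simp [hK.ne']
    · have := Real.exp_pos (-((1 : ℕ) : ℝ))
      simp only [Nat.cast_one, Real.one_rpow] at this ⊢
      linarith
  have hn1 : 1 ≤ n := by omega
  have hM' : (2 : ℝ) ≤ M := by exact_mod_cast hM
  have hd0 : 0 < totalDensity M d :=
    (mul_pos hc (Real.log_pos (by exact_mod_cast hn))).trans_le hd
  set D := 2 + ((M : ℝ) - 1) * (1 + K) / c with hD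
  have hM1 : 0 ≤ (M : ℝ) - 1 := by linarith
  have hD2 : 2 ≤ D := le_add_of_nonneg_right (by positivity)
  set w := (M : ℝ) * ((M : ℝ) - 1) with hw
  have hw2 : 2 ≤ w := by rw [hw]; nlinarith
  set r := Real.sqrt (totalDensity M d) with hr
  have hr0 : 0 < r := Real.sqrt_pos.2 hd0
  have hr2 : r ^ 2 = totalDensity M d := Real.sq_sqrt hd0.le
  obtain ⟨s, hs, hs1, hnet⟩ := exists_quarter_net (EuclideanSpace ℝ (Fin n))
  rw [finrank_euclideanSpace_fin] at hs
  set X : Ω → PotentialEdge n M → ℝ :=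
    fun ω e => (edgeEvent M H e).indicator (1 : Ω → ℝ) ω with hX
  have hX0 : ∀ ω e, 0 ≤ X ω e := fun ω e => Set.indicator_nonneg (fun _ _ => zero_le_one) ω
  set p : PotentialEdge n M → ℝ := fun e => P.real (edgeEvent M H e) with hp
  have hdeg := hH.prob_degree_gt_le hM hn1 hc hK hd
  have hdisc := hH.prob_exists_isDiscrepant_le hM hn1 hd0 hK
  have hlight := hH.prob_light_le hM hn1 hd0 hs hs1
  set G := {ω |
        matrixSpectralNorm
            (adjacencyMatrix M (fun m => H m ω) -
              expectedMatrix P (fun ω' => adjacencyMatrix M (fun m => H m ω'))) ≤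
          (512 * (M : ℝ) * ((M : ℝ) - 1) * (K + 6) * D) * r} with hG
  set B₁ := {ω | ∃ i, D * totalDensity M d < ∑ j, edgeMatrix (X ω) i j}
  set B₂ := {ω | ∃ I J : Finset (Fin n), I.Nonempty ∧ J.Nonempty ∧ I.card ≤ J.card ∧
    IsDiscrepant (edgeMatrix (X ω)) (totalDensity M d) (2 * w * (K + 4)) I J}
  set B₃ := {ω | ∃ x ∈ s, 16 * w * r ≤
      |∑ e : PotentialEdge n M, pairWeight (lightPart r x) e.1 * (X ω e - p e)|}
  have hgood : ∀ ω, ω ∉ B₁ → ω ∉ B₂ → ω ∉ B₃ → ω ∈ G := by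
    intro ω h1 h2 h3
    simp only [B₁, B₂, B₃, Set.mem_ofPred_eq, not_exists, not_and, not_lt, not_le] at h1 h2 h3
    set W := adjacencyMatrix M (fun m => H m ω) -
      expectedMatrix P (fun ω' => adjacencyMatrix M (fun m => H m ω')) with hW
    have hWe : ∀ i j, W i j = edgeMatrix (X ω) i j - edgeMatrix p i j := by
      intro i j
      rw [hW, Matrix.sub_apply, adjacencyMatrix_eq_edgeMatrix, hH.expectedMatrix_eq]
    have hWh : W.IsHermitian := by
      ext i j
      rw [Matrix.conjTranspose_apply, star_trivial, hWe, hWe, edgeMatrix_symm,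
        edgeMatrix_symm p]
    have hquad : ∀ x ∈ s, |∑ i, ∑ j, x i * x j * W i j| ≤
        16 * w * r + 8 * (r * (13 + 4 * D + 27 * (2 * w * (K + 4)))) + r := by
      intro x hx
      simp only [hWe]
      refine abs_quadratic_form_sub_le (by omega) hr0 (by linarith) (by positivity)
        (edgeMatrix_nonneg (hX0 ω)) (edgeMatrix_symm _)
        (edgeMatrix_nonneg fun e => measureReal_nonneg) (fun i j => ?_) ?_ (fun i => ?_)
        (fun I J hI hJ hIJ => ?_) ?_
      · rw [hr2]; exact hH.edgeMatrix_prob_le i j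
      · rw [← EuclideanSpace.real_norm_sq_eq]
        exact pow_le_one₀ (norm_nonneg _) (hs1 x hx)
      · rw [hr2]; exact h1 i
      · rw [hr2]; exact h2 I J hI hJ hIJ
      · simp only [← edgeMatrix_sub]
        rw [sum_mul_edgeMatrix]
        simp only [mul_comm _ (pairWeight _ _)]
        exact (h3 x hx).le
    refine (matrixSpectralNorm_le_of_net hWh hs1 hnet hquad).trans ?_
    calc _ = 2 * (16 * w + 8 * (13 + 4 * D + 27 * (2 * w * (K + 4))) + 1) * r := by ring
      _ ≤ 512 * w * (K + 6) * D * r :=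
          mul_le_mul_of_nonneg_right (spectral_constant_le hw2 hD2 hK) hr0.le
      _ = _ := by rw [hw]; ring
  -- Covering the whole space needs only monotonicity and subadditivity, so no measurability of the
  -- four events is required.
  have hcover : (Set.univ : Set Ω) ⊆ G ∪ (B₁ ∪ (B₂ ∪ B₃)) := by
    intro ω _
    by_contra hω
    simp only [Set.mem_union, not_or] at hω
    exact hω.1 (hgood ω hω.2.1 hω.2.2.1 hω.2.2.2)
  have h1 : (1 : ℝ) ≤ P.real (G ∪ (B₁ ∪ (B₂ ∪ B₃))) := by
    rw [← probReal_univ (μ := P)]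
    exact measureReal_mono hcover
  have h2 := measureReal_union_le (μ := P) G (B₁ ∪ (B₂ ∪ B₃))
  have h3 := measureReal_union_le (μ := P) B₁ (B₂ ∪ B₃)
  have h4 := measureReal_union_le (μ := P) B₂ B₃
  linarith
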